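/- For a graph $G$ and $k\ge 0$, call $G$ $k$-path-pairable if for any $k$ disjoint pairs of vertices $\{s_i,t_i\}$, $1\le i\le k$ (so the $2k$ vertices are distinct), there are pairwise edge-disjoint paths $P_1,\dots,P_k$ in $G$, where $P_i$ joins $s_i$ to $t_i$. For a finite graph $G$, the path-pairability number $pp(G)$ is the largest $k$ with $2k\le |V(G)|$ such that $G$ is $k$-path-pairable. Let $G(6,6)=P_6\Box P_6$ be the $6\times 6$ grid, the Cartesian product of two paths on six vertices, whose vertices are the pairs $(i,j)$ with $1\le i,j\le 6$ (row $i$, column $j$) and in which $(i,j)$ and $(p,q)$ are adjacent if and only if $|p-i|+|q-j|=1$. **Theorem.** $pp(G(6,6))=4$. More precisely: 1. The grid $G(6,6)$ is $4$-path-pairable: for every four disjoint pairs of vertices there are pairwise edge-disjoint paths joining each pair. 2. The grid $G(6,6)$ is not $5$-path-pairable. Explicitly, let $s_1=(1,1)$, $s_2=(2,1)$, $t_2=(1,3)$, $s_3=(3,1)$, $t_3=(1,2)$, $s_4=(3,2)$, $t_4=(2,3)$, $s_5=(2,2)$, and let $t_1,t_5$ be any two further distinct vertices of the grid. Then there are no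 pairwise edge-disjoint $s_i,t_i$-paths, $1\le i\le 5$, in $G(6,6)$. -/

import Mathlib

namespace SimpleGraph

variable {V : Type*}

/-- A choice of `k` disjoint pairs of vertices `{s i, t i}`: the `2 * k` terminals are distinct. -/
def IsTerminalPairing {k : ℕ} (s t : Fin k → V) : Prop :=
  Function.Injective (Sum.elim s t)

/-- The pairs `s i, t i` have a (weak) linkage in `G`: there are pairwise edge-disjoint
paths `P i` in `G` from `s i` to `t i`. -/
def HasEdgeDisjointLinkage (G : SimpleGraph V) {k : ℕ} (s t : Fin k → V) : Prop :=
  ∃ P : ∀ i : Fin k, G.Path (s i) (t i),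
    ∀ i j : Fin k, i ≠ j → List.Disjoint (P i).1.edges (P j).1.edges

/-- `G` is `k`-path-pairable: any `k` disjoint pairs of vertices can be joined by pairwise
edge-disjoint paths. -/
def IsPathPairable (G : SimpleGraph V) (k : ℕ) : Prop :=
  ∀ s t : Fin k → V, IsTerminalPairing s t → G.HasEdgeDisjointLinkage s t

/-- The path-pairability number: the largest `k` such that `G` is `k`-path-pairable.
Only those `k` count for which `k` disjoint pairs of vertices exist; for larger `k` the property
`IsPathPairable` is vacuous. On a finite vertex type the set below contains `0` and is bounded,
so the supremum is its greatest element. -/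
noncomputable def pathPairabilityNumber (G : SimpleGraph V) : ℕ :=
  sSup {k : ℕ | (∃ s t : Fin k → V, IsTerminalPairing s t) ∧ G.IsPathPairable k}

/-- The grid `P_a □ P_b`. The vertex in row `i` and column `j` (counted from `1`) is
`(i - 1, j - 1)`. -/
def grid (a b : ℕ) : SimpleGraph (Fin a × Fin b) :=
  pathGraph a □ pathGraph b

end SimpleGraph

/-! For the positive part, label every edge by a number from 0 to 4 so that at each vertex the edges
of label k ≠ 0 are odd in number exactly when the vertex is a terminal of pair k. In the subgraph of
label k the two terminals are then the only vertices of odd degree, so by the handshake lemma they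
lie in one component (`reachable_of_odd_degree`). Different labels use different edges. Linking the
pairs thus becomes a local parity problem in which no path has to be followed.

Such a labelling is assembled from the four 3 × 3 quadrants, each reflected so that its six exits
lie to the right and below. A quadrant matters to its neighbours only through the set of exit labels
it can realize, which a scan cell by cell computes as a mask of 5 ^ 6 bits (`stepOp`, `run`). If a
half of the grid has 3, 4 or 5 of the eight terminals, so has the opposite half. Both are tested
against one list of label patterns on the six edges between them: three terminals allow all
patterns, four allow more than half, five allow at least one, so some pattern suits both
(`le_countP`, `IsGridLabelling.solvable_of_half`). Otherwise some quadrant has at least six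
terminals together with either neighbour, and the rest of the grid is nearly empty
(`IsGridLabelling.solvable_of_quarter`). Only the fullest quadrant concerned is enumerated, up to
renaming labels (`search_sound`); the others enter through a `core`, the exits they can realize
wherever their terminals lie. The kernel evaluates the resulting finite checks. Only soundness of
the scan is proved: an incomplete scan could at worst make a check fail.

For the negative part, edge-disjoint paths give a labelling with the same parity property
(`exists_edge_labels`), and the conditions at eight vertices near the corner contradict each other
(`corner_labels_false`). The bad pairs extend to any larger number of pairs, so no k ≥ 5 counts. -/

namespace GridRouting

/-! ### Sets of boundary states as bit masks -/

/-- Evaluate a number to a literal before passing it on. -/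
noncomputable def force {α : Type} (x : ℕ) (k : ℕ → α) : α :=
  Nat.rec (motive := fun _ => α) (k 0) (fun m _ => k (Nat.shiftRight m 64))
    (Nat.succ (Nat.add (Nat.shiftLeft x 64) (Nat.mod x 18446744073709551557)))

noncomputable def forceList {α : Type} (l : List ℕ) : (List ℕ → α) → α :=
  List.rec (motive := fun _ => (List ℕ → α) → α) (fun k => k [])
    (fun x _ ih k => force x fun x => ih fun l => k (x :: l)) l

noncomputable def forceLists {α : Type} (l : List (List ℕ)) : (List (List ℕ) → α) → α :=
  List.rec (motive := fun _ => (List (List ℕ) → α) → α) (fun k => k [])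
    (fun x _ ih k => forceList x fun x => ih fun l => k (x :: l)) l

/-- The set of all `n < 5 ^ k` whose `p`-th digit in base five is `a`, as a bit mask. -/
noncomputable def digitMask (p a k : ℕ) : ℕ :=
  Nat.rec 1 (fun i X => force X fun X =>
    bif Nat.beq i p then
      -- Digits above 4 must give the empty set: `exceeds` asks for digits up to `d + 3`.
      bif Nat.ble a 4 then Nat.shiftLeft X (Nat.mul a (Nat.pow 5 i)) else 0
    else
      Nat.lor X (Nat.lor (Nat.shiftLeft X (Nat.mul 1 (Nat.pow 5 i)))
        (Nat.lor (Nat.shiftLeft X (Nat.mul 2 (Nat.pow 5 i)))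
          (Nat.lor (Nat.shiftLeft X (Nat.mul 3 (Nat.pow 5 i)))
            (Nat.shiftLeft X (Nat.mul 4 (Nat.pow 5 i))))))) k

noncomputable def digitIs (p a : ℕ) : ℕ := digitMask p a 6

noncomputable def bothAre (p q a : ℕ) : ℕ := Nat.land (digitIs p a) (digitIs q a)

/-- The states whose `p`-th digit exceeds the `q`-th digit by `d`. -/
noncomputable def exceeds (p q d : ℕ) : ℕ :=
  Nat.lor (Nat.land (digitIs p d) (digitIs q 0))
    (Nat.lor (Nat.land (digitIs p (Nat.add d 1)) (digitIs q 1))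
      (Nat.lor (Nat.land (digitIs p (Nat.add d 2)) (digitIs q 2))
        (Nat.land (digitIs p (Nat.add d 3)) (digitIs q 3))))

noncomputable def weight (p a : ℕ) : ℕ := Nat.mul a (Nat.pow 5 p)

noncomputable def weightDiff (p q d : ℕ) : ℕ := Nat.mul d (Nat.sub (Nat.pow 5 q) (Nat.pow 5 p))

noncomputable def weightSum (p q a : ℕ) : ℕ := Nat.mul a (Nat.add (Nat.pow 5 q) (Nat.pow 5 p))

/-- Exchanging digits p < q that differ by d changes every such state by the same amount d (5 ^ q -
5 ^ p), so one shift moves the whole set. The other operations rest on the same device. -/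
noncomputable def swapUp (p q d S : ℕ) : ℕ :=
  Nat.shiftLeft (Nat.land S (exceeds p q d)) (weightDiff p q d)

noncomputable def swapDown (p q d S : ℕ) : ℕ :=
  Nat.shiftRight (Nat.land S (exceeds q p d)) (weightDiff p q d)

noncomputable def swapOp (p q S : ℕ) : ℕ :=
  Nat.lor
    (Nat.lor (Nat.lor (swapUp p q 1 S) (swapUp p q 2 S))
      (Nat.lor (swapUp p q 3 S) (swapUp p q 4 S)))
    (Nat.lor (Nat.lor (swapDown p q 1 S) (swapDown p q 2 S))
      (Nat.lor (swapDown p q 3 S) (swapDown p q 4 S)))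

noncomputable def cancelOp (p q a S : ℕ) : ℕ :=
  Nat.shiftRight (Nat.land S (bothAre p q a)) (weightSum p q a)

/-- The term for 0 keeps the states whose two digits already vanish, so that `splitOp` can start
from them. -/
noncomputable def mergeOp (p q S : ℕ) : ℕ :=
  Nat.lor (cancelOp p q 0 S)
    (Nat.lor (Nat.lor (cancelOp p q 1 S) (cancelOp p q 2 S))
      (Nat.lor (cancelOp p q 3 S) (cancelOp p q 4 S)))

noncomputable def createOp (p q a S : ℕ) : ℕ :=
  Nat.shiftLeft (Nat.land S (bothAre p q 0)) (weightSum p q a)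

noncomputable def splitOp (p q S : ℕ) : ℕ :=
  Nat.lor (Nat.lor (createOp p q 1 S) (createOp p q 2 S))
    (Nat.lor (createOp p q 3 S) (createOp p q 4 S))

noncomputable def raiseOp (p t S : ℕ) : ℕ :=
  Nat.shiftLeft (Nat.land S (digitIs p 0)) (weight p t)

noncomputable def lowerOp (p t S : ℕ) : ℕ :=
  Nat.shiftRight (Nat.land S (digitIs p t)) (weight p t)

noncomputable def toggleOp (p q t S : ℕ) : ℕ :=
  Nat.lor (Nat.lor (raiseOp p t S) (lowerOp p t S)) (Nat.lor (raiseOp q t S) (lowerOp q t S))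

/-- Away from terminals the four edges pair off into equal labels: straight on (`S`), turning
(`swapOp`), or incoming with incoming (`mergeOp`) and outgoing with outgoing (`splitOp`). -/
noncomputable def passOp (p q S : ℕ) : ℕ :=
  force (mergeOp p q S) fun d => Nat.lor (Nat.lor S d) (Nat.lor (swapOp p q S) (splitOp p q d))

/-- All states that can follow those in `S` after a cell with terminal label `t`. -/
noncomputable def stepOp (p q t S : ℕ) : ℕ :=
  bif Nat.beq t 0 then passOp p q S
  -- At a terminal, t is switched on or off on one edge. Two equal incoming labels may be cancelled
  -- before this, and the edges then continue as at an ordinary vertex.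
  else force (Nat.lor S (mergeOp p q S)) fun S => force (toggleOp p q t S) fun S => passOp p q S

/-! ### Enumerating the placements of labels in a quadrant -/

/-- The positions of the column and of the row label of each cell in a state. -/
def cells : List (ℕ × ℕ) :=
  [(0, 3), (1, 3), (2, 3), (0, 4), (1, 4), (2, 4), (0, 5), (1, 5), (2, 5)]

def removeOne (x : ℕ) (l : List ℕ) : List ℕ :=
  List.rec [] (fun y ys ih => bif Nat.beq y x then ys else y :: ih) l

def allOf (l : List ℕ) (f : ℕ → Bool) : Bool :=
  List.rec true (fun x _ ih => bif f x then ih else false) l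

/-- Check `f` for the state sets of all ways to place the labels in the remaining cells, where the
labels in `O` and `P` are placed once, those in `A` twice, and the labels in `O`, and those in `A`,
appear in their order. -/
noncomputable def search (f : ℕ → Bool) (cs : List (ℕ × ℕ)) :
    ℕ → List ℕ → List ℕ → List ℕ → Bool :=
  List.rec (motive := fun _ => ℕ → List ℕ → List ℕ → List ℕ → Bool) (fun S _ _ _ => f S)
    (fun c cs ih S O A P =>
      bif (bif Nat.ble (Nat.add O.length (Nat.add (Nat.mul 2 A.length) P.length)) cs.length
          then force (stepOp c.1 c.2 0 S) fun S' => ih S' O A P else true) then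
      bif (List.rec (motive := fun _ => Bool) true
          (fun o O' _ => force (stepOp c.1 c.2 o S) fun S' => ih S' O' A P) O) then
      bif (List.rec (motive := fun _ => Bool) true
          (fun a A' _ => force (stepOp c.1 c.2 a S) fun S' => ih S' O A' (a :: P)) A) then
      allOf P fun x => force (stepOp c.1 c.2 x S) fun S' => ih S' O A (removeOne x P)
      else false else false else false) cs

noncomputable def coreFold (l : List ℕ) (f : ℕ → ℕ) (s : ℕ) : ℕ :=
  List.rec s (fun x _ ih => Nat.land (f x) ih) l

/-- The intersection of the state sets of all ways to place the labels `l` in the cells. -/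
noncomputable def coreFrom (cs : List (ℕ × ℕ)) : ℕ → List ℕ → ℕ :=
  List.rec (motive := fun _ => ℕ → List ℕ → ℕ) (fun S _ => S)
    (fun c cs ih S l =>
      Nat.land
        (bif Nat.ble l.length cs.length then force (stepOp c.1 c.2 0 S) fun S' => ih S' l
          -- The set of all 5 ^ 6 = 15625 states, neutral for intersection, stands for a branch
          -- without placements.
          else Nat.sub (Nat.pow 2 15625) 1)
        (coreFold l (fun x => force (stepOp c.1 c.2 x S) fun S' => ih S' (removeOne x l))
          (Nat.sub (Nat.pow 2 15625) 1))) cs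

/-- A state in the core is available wherever the terminals lie, so the core depends only on the
multiset of labels in the quadrant. -/
noncomputable def core (l : List ℕ) : ℕ := coreFrom cells 1 l

/-! ### Tests for joining quadrants -/

/-- The column labels that occur in `C` with row labels `k`. -/
noncomputable def slice (C k : ℕ) : ℕ :=
  Nat.land (Nat.shiftRight C (Nat.mul 125 k)) (Nat.sub (Nat.pow 2 125) 1)

/-- The part of `C` with row labels `k`, with the row labels replaced by `k'`. -/
noncomputable def transfer (C k k' : ℕ) : ℕ := Nat.shiftLeft (slice C k) (Nat.mul 125 k')

noncomputable def hits (S : ℕ) (ds : List ℕ) : ℕ :=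
  List.rec 0 (fun d _ ih => bif Nat.beq (Nat.land S d) 0 then ih else Nat.add ih 1) ds

/-- A test is a list whose head is the number of hits that the tail must have. -/
noncomputable def passes (S : ℕ) (test : List ℕ) : Bool :=
  List.rec true (fun thr ds _ => Nat.ble thr (hits S ds)) test

noncomputable def passesAll (tests : List (List ℕ)) (S : ℕ) : Bool :=
  List.rec true (fun t _ ih => bif passes S t then ih else false) tests

abbrev Triple := ℕ × ℕ × ℕ

def Triple.code (x : Triple) : ℕ := Nat.add x.1 (Nat.mul 5 (Nat.add x.2.1 (Nat.mul 5 x.2.2)))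

/-- Each triple lists row exits from the outer border towards the middle. The particular arrangement
matters only for the outcome of the computed tests; the proofs use that it commutes with relabelling
and introduces no label except 0. -/
def spread : List ℕ → Triple × Triple
  | [a] => ((a, 0, 0), (0, 0, 0))
  | [a, b] => ((a, 0, b), (0, 0, 0))
  | [a, b, c] => ((a, 0, b), (0, 0, c))
  | [a, b, c, d] => ((a, 0, b), (0, c, d))
  | _ => ((0, 0, 0), (0, 0, 0))

/-- The exit patterns used to join the two halves of the grid. -/
def patterns (l : List ℕ) : List (Triple × Triple) :=
  l.permutations'.flatMap fun o => [spread o, (spread o).swap]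

/-- All patterns, a strict majority, or one, for three, four or five terminals: for two halves with
eight terminals together the thresholds add up to more than the number of patterns. -/
def threshold (n len : ℕ) : ℕ :=
  bif Nat.beq n 3 then len else bif Nat.beq n 4 then Nat.add (Nat.div len 2) 1 else 1

/-- How often a label occurs in each of the four quadrants. -/
abbrev Role := ℕ × ℕ × ℕ × ℕ

abbrev Roles := Role × Role × Role × Role

/-- The labels, with multiplicities given by `g`. -/
def labelsBy (ρ : Roles) (g : Role → ℕ) : List ℕ :=
  List.replicate (g ρ.1) 1 ++ (List.replicate (g ρ.2.1) 2 ++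
    (List.replicate (g ρ.2.2.1) 3 ++ List.replicate (g ρ.2.2.2) 4))

/-- A pair with exactly one terminal in the first two quadrants has to cross into the other half. -/
def crossing (r : Role) : ℕ := bif Nat.beq (Nat.add r.1 r.2.1) 1 then 1 else 0

def total (ρ : Roles) (g : Role → ℕ) : ℕ :=
  Nat.add (g ρ.1) (Nat.add (g ρ.2.1) (Nat.add (g ρ.2.2.1) (g ρ.2.2.2)))

/-- The test for a half of the grid: enough exit patterns can be realized. -/
noncomputable def halfTest (ρ : Roles) : List ℕ :=
  force (core (labelsBy ρ fun r => r.2.1)) fun C =>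
    threshold (Nat.add (total ρ fun r => r.1) (total ρ fun r => r.2.1))
      (patterns (labelsBy ρ crossing)).length ::
    -- Rows `k.2` of the core are renamed `k.1`, so a common bit with a state set of the first
    -- quadrant means that both quadrants agree on the column exits.
    (patterns (labelsBy ρ crossing)).map fun k => transfer C k.2.code k.1.code

def halfRoles (c : ℕ) : List Role :=
  bif Nat.beq c 0 then [(0, 0, 0, 0), (0, 1, 0, 0), (0, 2, 0, 0)]
  else bif Nat.beq c 1 then [(1, 0, 0, 0), (1, 1, 0, 0)] else [(2, 0, 0, 0)]

def quarterRoles (c : ℕ) : List Role :=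
  bif Nat.beq c 0 then
    [(0, 2, 0, 0), (0, 0, 2, 0), (0, 0, 0, 2), (0, 1, 1, 0), (0, 1, 0, 1), (0, 0, 1, 1)]
  else bif Nat.beq c 1 then [(1, 1, 0, 0), (1, 0, 1, 0), (1, 0, 0, 1)] else [(2, 0, 0, 0)]

def product (f : ℕ → List Role) (c : ℕ × ℕ × ℕ × ℕ) : List Roles :=
  (f c.1).flatMap fun a => (f c.2.1).flatMap fun b => (f c.2.2.1).flatMap fun d =>
    (f c.2.2.2).map fun e => (a, b, d, e)

def isHalf (ρ : Roles) : Bool :=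
  Nat.ble (total ρ fun r => r.2.1) (total ρ fun r => r.1) &&
  (Nat.ble 3 (Nat.add (total ρ fun r => r.1) (total ρ fun r => r.2.1)) &&
   Nat.ble (Nat.add (total ρ fun r => r.1) (total ρ fun r => r.2.1)) 5)

def isQuarter (ρ : Roles) : Bool :=
  Nat.ble (total ρ fun r => r.2.1) (total ρ fun r => r.2.2.1) &&
  (Nat.ble 6 (Nat.add (total ρ fun r => r.1) (total ρ fun r => r.2.1)) &&
   Nat.ble 6 (Nat.add (total ρ fun r => r.1) (total ρ fun r => r.2.2.1)))

/-- Codes of all ways to place the labels `l` on `n` edges. -/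
def placements (n : ℕ) : List ℕ → List ℕ :=
  Nat.rec (fun _ => [0]) (fun n ih l =>
    (bif Nat.ble l.length n then (ih l).map (Nat.mul 5) else []) ++
    l.flatMap fun x => (ih (removeOne x l)).map fun y => Nat.add x (Nat.mul 5 y)) n

/-- Besides the necessary crossings, one pair with both terminals in the first quadrant may make a
detour through the other half, at the cost of two edges. -/
def candidates (ρ : Roles) : List ℕ :=
  placements 6 (labelsBy ρ crossing) ++
    (labelsBy ρ fun r => Nat.div r.1 2).flatMap fun x =>
      placements 6 (x :: x :: labelsBy ρ crossing)

/-- In a code `k`, the remainder modulo 125 holds the row exits shared by the northern quadrants and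
the quotient those shared by the southern ones. A code counts if the cores of the eastern quadrants
have common column exits. -/
noncomputable def exitsFold (C₂ C₃ C₄ : ℕ) (l : List ℕ) : ℕ → ℕ :=
  List.rec (motive := fun _ => ℕ → ℕ) (fun acc => acc) (fun k _ ih acc =>
    bif Nat.beq (Nat.land (slice C₃ (Nat.mod k 125)) (slice C₄ (Nat.div k 125))) 0 then ih acc
    else force (Nat.lor acc (transfer C₂ (Nat.div k 125) (Nat.mod k 125))) ih) l

/-- The test for a quadrant with most of the terminals. -/
noncomputable def quarterTest (ρ : Roles) : List ℕ :=
  force (core (labelsBy ρ fun r => r.2.1)) fun C₂ =>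
  force (core (labelsBy ρ fun r => r.2.2.1)) fun C₃ =>
  force (core (labelsBy ρ fun r => r.2.2.2)) fun C₄ =>
    [1, exitsFold C₂ C₃ C₄ (candidates ρ) 0]

def columns (m a : ℕ) : ℕ × ℕ × ℕ × ℕ :=
  let f := fun i => bif Nat.ble i m then 1 else bif Nat.ble i (Nat.add m a) then 2 else 0
  (f 1, f 2, f 3, f 4)

noncomputable def testsFor (m a : ℕ) : List (List ℕ) :=
  ((product halfRoles (columns m a)).filter isHalf).map halfTest ++
  ((product quarterRoles (columns m a)).filter isQuarter).map quarterTest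

/-- All placements of `m` single and `a` double labels in a quadrant pass the tests. -/
noncomputable def check (m a : ℕ) : Bool :=
  forceLists (testsFor m a) fun tests =>
    search (passesAll tests) cells 1 (List.range' 1 m) (List.range' (m + 1) a) []

/-! ### Arithmetic of masks and base-five digits -/

/-- Reducing the recursor requires its argument as a literal, which is what makes `force` evaluate
`x`. The added remainder is below 2 ^ 64 and is discarded by the shift. -/
theorem force_eq {α : Type} (x : ℕ) (k : ℕ → α) : force x k = k x := by
  change k (Nat.shiftRight (Nat.add (Nat.shiftLeft x 64) (Nat.mod x 18446744073709551557)) 64) = k x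
  congr 1
  change (x <<< 64 + x % 18446744073709551557) >>> 64 = x
  rw [Nat.shiftRight_eq_div_pow, Nat.shiftLeft_eq]
  omega

theorem forceList_eq {α : Type} (l : List ℕ) (k : List ℕ → α) : forceList l k = k l := by
  induction l generalizing k with
  | nil => rfl
  | cons x l ih =>
    change force x (fun x => forceList l fun l => k (x :: l)) = _
    rw [force_eq, ih]

theorem forceLists_eq {α : Type} (l : List (List ℕ)) (k : List (List ℕ) → α) :
    forceLists l k = k l := by
  induction l generalizing k with
  | nil => rfl
  | cons x l ih =>
    change forceList x (fun x => forceLists l fun l => k (x :: l)) = _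
    rw [forceList_eq, ih]

theorem testBit_shl (x i j : ℕ) :
    (Nat.shiftLeft x i).testBit j = true ↔ i ≤ j ∧ x.testBit (j - i) = true := by
  change (x <<< i).testBit j = true ↔ _
  simp [Nat.testBit_shiftLeft]

theorem testBit_shr (x i j : ℕ) :
    (Nat.shiftRight x i).testBit j = true ↔ x.testBit (i + j) = true := by
  change (x >>> i).testBit j = true ↔ _
  simp [Nat.testBit_shiftRight]

theorem testBit_land' (x y j : ℕ) :
    (Nat.land x y).testBit j = true ↔ x.testBit j = true ∧ y.testBit j = true := by
  change (x &&& y).testBit j = true ↔ _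
  simp

theorem testBit_lor' (x y j : ℕ) :
    (Nat.lor x y).testBit j = true ↔ x.testBit j = true ∨ y.testBit j = true := by
  change (x ||| y).testBit j = true ↔ _
  simp

/-- The `p`-th digit of `n` in base five. -/
def digit (n p : ℕ) : ℕ := n / 5 ^ p % 5

theorem digit_lt (n p : ℕ) : digit n p < 5 := Nat.mod_lt _ (by norm_num)

theorem digit_decomp (n p : ℕ) :
    n = n / 5 ^ (p + 1) * 5 ^ (p + 1) + digit n p * 5 ^ p + n % 5 ^ p := by
  have h1 := Nat.div_add_mod n (5 ^ p)
  have h2 := Nat.div_add_mod (n / 5 ^ p) 5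
  rw [Nat.div_div_eq_div_mul, ← pow_succ] at h2
  unfold digit
  calc n = 5 ^ p * (n / 5 ^ p) + n % 5 ^ p := h1.symm
    _ = 5 ^ p * (5 * (n / 5 ^ (p + 1)) + n / 5 ^ p % 5) + n % 5 ^ p := by rw [h2]
    _ = _ := by ring

theorem digit_build (H c L p x : ℕ) (hc : c < 5) (hL : L < 5 ^ p) :
    digit (H * 5 ^ (p + 1) + c * 5 ^ p + L) x =
      if x = p then c else if x < p then digit L x else digit H (x - p - 1) := by
  have hd : (H * 5 ^ (p + 1) + c * 5 ^ p + L) / 5 ^ p = H * 5 + c := by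
    have : H * 5 ^ (p + 1) + c * 5 ^ p + L = L + 5 ^ p * (H * 5 + c) := by ring
    rw [this, Nat.add_mul_div_left _ _ (by positivity), Nat.div_eq_of_lt hL, zero_add]
  unfold digit
  split_ifs with h1 h2
  · subst h1; rw [hd]; omega
  · obtain ⟨d, rfl⟩ : ∃ d, p = x + 1 + d := ⟨p - x - 1, by omega⟩
    have : H * 5 ^ (x + 1 + d + 1) + c * 5 ^ (x + 1 + d) + L
        = L + 5 ^ x * (5 * (H * 5 ^ (d + 1) + c * 5 ^ d)) := by ring
    rw [this, Nat.add_mul_div_left _ _ (by positivity)]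
    omega
  · obtain ⟨d, rfl⟩ : ∃ d, x = p + 1 + d := ⟨x - p - 1, by omega⟩
    have e : p + 1 + d - p - 1 = d := by omega
    rw [e, show (5 : ℕ) ^ (p + 1 + d) = 5 ^ p * (5 * 5 ^ d) by ring, ← Nat.div_div_eq_div_mul, hd,
      ← Nat.div_div_eq_div_mul]
    congr 2
    omega

theorem digit_of_add_eq {n n' p c : ℕ} (hc : c < 5)
    (h : n' + digit n p * 5 ^ p = n + c * 5 ^ p) :
    digit n' p = c ∧ ∀ x, x ≠ p → digit n' x = digit n x := by
  have hn := digit_decomp n p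
  have hL : n % 5 ^ p < 5 ^ p := Nat.mod_lt _ (by positivity)
  have hn' : n' = n / 5 ^ (p + 1) * 5 ^ (p + 1) + c * 5 ^ p + n % 5 ^ p := by omega
  refine ⟨?_, fun x hx => ?_⟩
  · rw [hn', digit_build _ _ _ _ _ hc hL, if_pos rfl]
  · conv_rhs => rw [hn]
    rw [hn', digit_build _ _ _ _ _ hc hL, digit_build _ _ _ _ _ (digit_lt _ _) hL, if_neg hx,
      if_neg hx]

theorem testBit_digitMask (p a k n : ℕ) (h : (digitMask p a k).testBit n = true) :
    n < 5 ^ k ∧ (p < k → digit n p = a) := by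
  induction k generalizing n with
  | zero =>
    change Nat.testBit 1 n = true at h
    rw [Nat.testBit_one_eq_true_iff_self_eq_zero] at h
    subst h; simp
  | succ k ih =>
    -- Shifting by c * 5 ^ k writes c as a new leading digit.
    have key : ∀ c, c < 5 → (Nat.shiftLeft (digitMask p a k) (Nat.mul c (Nat.pow 5 k))).testBit n
        = true → n < 5 ^ (k + 1) ∧ digit n k = c ∧ (p < k → digit n p = a) := by
      intro c hc h
      rw [testBit_shl] at h
      obtain ⟨h1, h2⟩ := h
      obtain ⟨h3, h4⟩ := ih _ h2
      change c * 5 ^ k ≤ n at h1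
      change n - c * 5 ^ k < 5 ^ k at h3
      change p < k → digit (n - c * 5 ^ k) p = a at h4
      have hn : n = 0 * 5 ^ (k + 1) + c * 5 ^ k + (n - c * 5 ^ k) := by omega
      refine ⟨?_, ?_, fun hp => ?_⟩
      · have : c * 5 ^ k ≤ 4 * 5 ^ k := Nat.mul_le_mul_right _ (by omega)
        rw [pow_succ]; omega
      · rw [hn, digit_build _ _ _ _ _ hc h3, if_pos rfl]
      · rw [← h4 hp, hn, digit_build _ _ _ _ _ hc h3, if_neg hp.ne, if_pos hp]
        congr 1; omega
    have e : digitMask p a (k + 1) = (bif Nat.beq k p then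
      bif Nat.ble a 4 then Nat.shiftLeft (digitMask p a k) (Nat.mul a (Nat.pow 5 k)) else 0
    else
      Nat.lor (digitMask p a k) (Nat.lor (Nat.shiftLeft (digitMask p a k) (Nat.mul 1 (Nat.pow 5 k)))
        (Nat.lor (Nat.shiftLeft (digitMask p a k) (Nat.mul 2 (Nat.pow 5 k)))
          (Nat.lor (Nat.shiftLeft (digitMask p a k) (Nat.mul 3 (Nat.pow 5 k)))
            (Nat.shiftLeft (digitMask p a k) (Nat.mul 4 (Nat.pow 5 k))))))) := by
      exact force_eq (digitMask p a k) fun X => bif Nat.beq k p then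
        bif Nat.ble a 4 then Nat.shiftLeft X (Nat.mul a (Nat.pow 5 k)) else 0
      else
        Nat.lor X (Nat.lor (Nat.shiftLeft X (Nat.mul 1 (Nat.pow 5 k)))
          (Nat.lor (Nat.shiftLeft X (Nat.mul 2 (Nat.pow 5 k)))
            (Nat.lor (Nat.shiftLeft X (Nat.mul 3 (Nat.pow 5 k)))
              (Nat.shiftLeft X (Nat.mul 4 (Nat.pow 5 k))))))
    rw [e] at h
    rcases hb : Nat.beq k p with _ | _
    · rw [hb, cond_false] at h
      have hkp : k ≠ p := by
        rintro rfl
        simp at hb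
      have h0 : (digitMask p a k).testBit n = true →
          (Nat.shiftLeft (digitMask p a k) (Nat.mul 0 (Nat.pow 5 k))).testBit n = true := by
        intro h
        rw [testBit_shl]
        change 0 * 5 ^ k ≤ n ∧ (digitMask p a k).testBit (n - 0 * 5 ^ k) = true
        simpa using h
      have : n < 5 ^ (k + 1) ∧ (p < k → digit n p = a) := by
        simp only [testBit_lor'] at h
        rcases h with h | h | h | h | h
        · exact ⟨(key 0 (by omega) (h0 h)).1, (key 0 (by omega) (h0 h)).2.2⟩
        · exact ⟨(key 1 (by omega) h).1, (key 1 (by omega) h).2.2⟩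
        · exact ⟨(key 2 (by omega) h).1, (key 2 (by omega) h).2.2⟩
        · exact ⟨(key 3 (by omega) h).1, (key 3 (by omega) h).2.2⟩
        · exact ⟨(key 4 (by omega) h).1, (key 4 (by omega) h).2.2⟩
      exact ⟨this.1, fun hp => this.2 (by omega)⟩
    · rw [hb, cond_true] at h
      have hkp : k = p := Nat.eq_of_beq_eq_true hb
      rcases ha : Nat.ble a 4 with _ | _
      · rw [ha, cond_false] at h
        simp at h
      · rw [ha, cond_true] at h
        have := key a (by have := Nat.le_of_ble_eq_true ha; omega) h
        exact ⟨this.1, fun _ => hkp ▸ this.2.1⟩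

theorem testBit_digitIs {p a n : ℕ} (hp : p < 6) (h : (digitIs p a).testBit n = true) :
    digit n p = a :=
  (testBit_digitMask p a 6 n h).2 hp

theorem testBit_bothAre {p q a n : ℕ} (hp : p < 6) (hq : q < 6)
    (h : (bothAre p q a).testBit n = true) : digit n p = a ∧ digit n q = a := by
  unfold bothAre at h
  rw [testBit_land'] at h
  exact ⟨testBit_digitIs hp h.1, testBit_digitIs hq h.2⟩

theorem testBit_exceeds {p q d n : ℕ} (hp : p < 6) (hq : q < 6)
    (h : (exceeds p q d).testBit n = true) : digit n p = digit n q + d := by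
  unfold exceeds at h
  simp only [testBit_lor', testBit_land'] at h
  rcases h with ⟨h, h'⟩ | ⟨h, h'⟩ | ⟨h, h'⟩ | ⟨h, h'⟩ <;>
  · rw [testBit_digitIs hp h, testBit_digitIs hq h']
    first | omega | (simp only [Nat.add_eq]; omega)

/-! ### Local parity condition and soundness of the scan -/

/-- `1` if the label `x` is `k`, and `0` otherwise. -/
def hit (k x : ℕ) : ℕ := if x = k then 1 else 0

/-- Around a vertex with terminal label `t` (`0` at a vertex that is no terminal) the edges with a
given nonzero label `k` are odd in number if and only if `t = k`. -/
def Balanced (t u l d r : ℕ) : Prop :=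
  ∀ k, k ≠ 0 → Even (hit k t + hit k u + hit k l + hit k d + hit k r)

/-- The passage from state `n` to state `n'` at a vertex with terminal label `t`, where the digits
`p`, `q` hold the labels of the incoming edges before and of the outgoing ones after. -/
def Move (p q t n n' : ℕ) : Prop :=
  (∀ x, x ≠ p → x ≠ q → digit n' x = digit n x) ∧
    Balanced t (digit n p) (digit n q) (digit n' p) (digit n' q)

theorem hit_zero {k : ℕ} (hk : k ≠ 0) : hit k 0 = 0 := if_neg hk.symm

/-- The labels between the two moves are counted twice and drop out modulo 2. -/
theorem Move.trans_left {p q t n n' n'' : ℕ} (h : Move p q t n n') (h' : Move p q 0 n' n'') :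
    Move p q t n n'' := by
  refine ⟨fun x hp hq => (h'.1 x hp hq).trans (h.1 x hp hq), fun k hk => ?_⟩
  have h1 := h.2 k hk
  have h2 := h'.2 k hk
  rw [hit_zero hk] at h2
  rw [Nat.even_iff] at *
  omega

theorem Move.trans_right {p q t n n' n'' : ℕ} (h : Move p q 0 n n') (h' : Move p q t n' n'') :
    Move p q t n n'' := by
  refine ⟨fun x hp hq => (h'.1 x hp hq).trans (h.1 x hp hq), fun k hk => ?_⟩
  have h1 := h.2 k hk
  have h2 := h'.2 k hk
  rw [hit_zero hk] at h1
  rw [Nat.even_iff] at *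
  omega

theorem Move.refl (p q n : ℕ) : Move p q 0 n n := by
  refine ⟨fun x _ _ => rfl, fun k hk => ?_⟩
  rw [hit_zero hk, Nat.even_iff]
  omega

/-- All states in `op S` arise from states in `S`. -/
def Sound (p q t : ℕ) (op : ℕ → ℕ) : Prop :=
  ∀ S n', (op S).testBit n' = true → ∃ n, S.testBit n = true ∧ Move p q t n n'

theorem Sound.lor {p q t : ℕ} {f g : ℕ → ℕ} (hf : Sound p q t f) (hg : Sound p q t g) :
    Sound p q t fun S => Nat.lor (f S) (g S) := by
  intro S n' h
  rw [testBit_lor'] at h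
  exact h.elim (hf S n') (hg S n')

theorem Sound.id (p q : ℕ) : Sound p q 0 fun S => S :=
  fun _ n' h => ⟨n', h, Move.refl p q n'⟩

theorem Sound.comp_left {p q t : ℕ} {f g : ℕ → ℕ} (hf : Sound p q t f) (hg : Sound p q 0 g) :
    Sound p q t fun S => g (f S) := by
  intro S n' h
  obtain ⟨n, hn, hm⟩ := hg _ _ h
  obtain ⟨n₀, hn₀, hm₀⟩ := hf _ _ hn
  exact ⟨n₀, hn₀, hm₀.trans_left hm⟩

theorem Sound.comp_right {p q t : ℕ} {f g : ℕ → ℕ} (hf : Sound p q 0 f) (hg : Sound p q t g) :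
    Sound p q t fun S => g (f S) := by
  intro S n' h
  obtain ⟨n, hn, hm⟩ := hg _ _ h
  obtain ⟨n₀, hn₀, hm₀⟩ := hf _ _ hn
  exact ⟨n₀, hn₀, hm₀.trans_right hm⟩

/-- The two digits are changed one after the other without carries. Each mask operation is thereby
reduced to one equation between numbers and one parity condition. -/
theorem move_of_add_eq {p q t n n' c d : ℕ} (hpq : p ≠ q) (hc : c < 5) (hd : d < 5)
    (h : n' + (digit n p * 5 ^ p + digit n q * 5 ^ q) = n + (c * 5 ^ p + d * 5 ^ q))
    (hb : Balanced t (digit n p) (digit n q) c d) : Move p q t n n' := by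
  have hle : digit n p * 5 ^ p ≤ n := by
    have := digit_decomp n p
    have : n = (n / 5 ^ (p + 1) * 5 ^ (p + 1) + n % 5 ^ p) + digit n p * 5 ^ p := by omega
    omega
  obtain ⟨m, hm⟩ : ∃ m, m + digit n p * 5 ^ p = n + c * 5 ^ p :=
    ⟨n + c * 5 ^ p - digit n p * 5 ^ p, by omega⟩
  obtain ⟨h1, h2⟩ := digit_of_add_eq hc hm
  have hq := h2 q hpq.symm
  obtain ⟨h3, h4⟩ := digit_of_add_eq (n := m) (n' := n') (p := q) hd (by rw [hq]; omega)
  refine ⟨fun x hx hx' => (h4 x hx').trans (h2 x hx), ?_⟩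
  rwa [h3, h4 p hpq, h1]

theorem balanced_swap (u l : ℕ) : Balanced 0 u l l u := by
  intro k hk
  rw [hit_zero hk, Nat.even_iff]
  omega

theorem balanced_pair (a b : ℕ) : Balanced 0 a a b b := by
  intro k hk
  rw [hit_zero hk, Nat.even_iff]
  omega

theorem weightDiff_eq {p q : ℕ} (hpq : p < q) (d : ℕ) :
    weightDiff p q d + d * 5 ^ p = d * 5 ^ q := by
  change d * (5 ^ q - 5 ^ p) + d * 5 ^ p = d * 5 ^ q
  rw [← Nat.mul_add, Nat.sub_add_cancel (Nat.pow_le_pow_right (by norm_num) hpq.le)]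

theorem weightSum_eq (p q a : ℕ) : weightSum p q a = a * 5 ^ p + a * 5 ^ q := by
  change a * (5 ^ q + 5 ^ p) = _
  ring

theorem sound_swapUp {p q : ℕ} (hpq : p < q) (hq : q < 6) (d : ℕ) : Sound p q 0 (swapUp p q d) := by
  intro S n' h
  unfold swapUp at h
  rw [testBit_shl, testBit_land'] at h
  obtain ⟨h1, h2, h3⟩ := h
  have h4 := testBit_exceeds (hpq.trans hq) hq h3
  refine ⟨_, h2, move_of_add_eq hpq.ne (digit_lt _ _) (digit_lt _ _) ?_ (balanced_swap _ _)⟩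
  have := weightDiff_eq hpq d
  rw [h4, Nat.add_mul, Nat.add_mul]
  omega

theorem sound_swapDown {p q : ℕ} (hpq : p < q) (hq : q < 6) (d : ℕ) :
    Sound p q 0 (swapDown p q d) := by
  intro S n' h
  unfold swapDown at h
  rw [testBit_shr, testBit_land'] at h
  obtain ⟨h2, h3⟩ := h
  have h4 := testBit_exceeds hq (hpq.trans hq) h3
  refine ⟨_, h2, move_of_add_eq hpq.ne (digit_lt _ _) (digit_lt _ _) ?_ (balanced_swap _ _)⟩
  have := weightDiff_eq hpq d
  rw [h4, Nat.add_mul, Nat.add_mul]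
  omega

theorem sound_swapOp {p q : ℕ} (hpq : p < q) (hq : q < 6) : Sound p q 0 (swapOp p q) := by
  have h := fun d => sound_swapUp hpq hq d
  have h' := fun d => sound_swapDown hpq hq d
  exact (((h 1).lor (h 2)).lor ((h 3).lor (h 4))).lor (((h' 1).lor (h' 2)).lor ((h' 3).lor (h' 4)))

theorem sound_cancelOp {p q : ℕ} (hpq : p < q) (hq : q < 6) (a : ℕ) :
    Sound p q 0 (cancelOp p q a) := by
  intro S n' h
  unfold cancelOp at h
  rw [testBit_shr, testBit_land'] at h
  obtain ⟨h2, h3⟩ := h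
  have h4 := testBit_bothAre (hpq.trans hq) hq h3
  refine ⟨_, h2, move_of_add_eq (c := 0) (d := 0) hpq.ne (by norm_num) (by norm_num) ?_ ?_⟩
  · rw [h4.1, h4.2, weightSum_eq]
    omega
  · rw [h4.1, h4.2]
    exact balanced_pair _ _

theorem sound_mergeOp {p q : ℕ} (hpq : p < q) (hq : q < 6) : Sound p q 0 (mergeOp p q) := by
  have h := fun d => sound_cancelOp hpq hq d
  exact (h 0).lor (((h 1).lor (h 2)).lor ((h 3).lor (h 4)))

theorem sound_createOp {p q : ℕ} (hpq : p < q) (hq : q < 6) (a : ℕ) (ha : a < 5) :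
    Sound p q 0 (createOp p q a) := by
  intro S n' h
  unfold createOp at h
  rw [testBit_shl, testBit_land'] at h
  obtain ⟨h1, h2, h3⟩ := h
  have h4 := testBit_bothAre (hpq.trans hq) hq h3
  refine ⟨_, h2, move_of_add_eq (c := a) (d := a) hpq.ne ha ha ?_ ?_⟩
  · rw [h4.1, h4.2]
    rw [weightSum_eq] at h1 ⊢
    omega
  · rw [h4.1, h4.2]
    exact balanced_pair _ _

theorem sound_splitOp {p q : ℕ} (hpq : p < q) (hq : q < 6) : Sound p q 0 (splitOp p q) := by
  have h := fun d hd => sound_createOp hpq hq d hd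
  exact ((h 1 (by norm_num)).lor (h 2 (by norm_num))).lor
    ((h 3 (by norm_num)).lor (h 4 (by norm_num)))

theorem sound_toggleOp {p q t : ℕ} (hpq : p < q) (hq : q < 6) (ht : t < 5) :
    Sound p q t (toggleOp p q t) := by
  have hp := hpq.trans hq
  have bal₁ : ∀ x, Balanced t 0 x t x := by
    intro x k hk
    rw [hit_zero hk, Nat.even_iff]
    omega
  have bal₂ : ∀ x, Balanced t t x 0 x := by
    intro x k hk
    rw [hit_zero hk, Nat.even_iff]
    omega
  have bal₃ : ∀ x, Balanced t x 0 x t := by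
    intro x k hk
    rw [hit_zero hk, Nat.even_iff]
    omega
  have bal₄ : ∀ x, Balanced t x t x 0 := by
    intro x k hk
    rw [hit_zero hk, Nat.even_iff]
    omega
  have wt : ∀ p, weight p t = t * 5 ^ p := fun _ => rfl
  refine Sound.lor (Sound.lor ?_ ?_) (Sound.lor ?_ ?_) <;> intro S n' h
  · unfold raiseOp at h
    rw [testBit_shl, testBit_land', wt] at h
    obtain ⟨h1, h2, h3⟩ := h
    set n := n' - t * 5 ^ p with hn
    have h4 := testBit_digitIs hp h3
    refine ⟨_, h2, ?_⟩
    refine move_of_add_eq (c := t) hpq.ne ht (digit_lt n q) ?_ ?_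
    · rw [h4]; omega
    · rw [h4]; exact bal₁ _
  · unfold lowerOp at h
    rw [testBit_shr, testBit_land', wt] at h
    obtain ⟨h2, h3⟩ := h
    set n := t * 5 ^ p + n' with hn
    have h4 := testBit_digitIs hp h3
    refine ⟨_, h2, ?_⟩
    refine move_of_add_eq (c := 0) hpq.ne (by norm_num) (digit_lt n q) ?_ ?_
    · rw [h4]; omega
    · rw [h4]; exact bal₂ _
  · unfold raiseOp at h
    rw [testBit_shl, testBit_land', wt] at h
    obtain ⟨h1, h2, h3⟩ := h
    set n := n' - t * 5 ^ q with hn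
    have h4 := testBit_digitIs hq h3
    refine ⟨_, h2, ?_⟩
    refine move_of_add_eq (d := t) hpq.ne (digit_lt n p) ht ?_ ?_
    · rw [h4]; omega
    · rw [h4]; exact bal₃ _
  · unfold lowerOp at h
    rw [testBit_shr, testBit_land', wt] at h
    obtain ⟨h2, h3⟩ := h
    set n := t * 5 ^ q + n' with hn
    have h4 := testBit_digitIs hq h3
    refine ⟨_, h2, ?_⟩
    refine move_of_add_eq (d := 0) hpq.ne (digit_lt n p) (by norm_num) ?_ ?_
    · rw [h4]; omega
    · rw [h4]; exact bal₄ _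

theorem sound_passOp {p q : ℕ} (hpq : p < q) (hq : q < 6) : Sound p q 0 (passOp p q) := by
  have e : passOp p q = fun S => Nat.lor (Nat.lor S (mergeOp p q S))
      (Nat.lor (swapOp p q S) (splitOp p q (mergeOp p q S))) := by
    funext S
    exact force_eq _ _
  rw [e]
  exact ((Sound.id p q).lor (sound_mergeOp hpq hq)).lor
    ((sound_swapOp hpq hq).lor ((sound_mergeOp hpq hq).comp_left (sound_splitOp hpq hq)))

theorem sound_stepOp {p q t : ℕ} (hpq : p < q) (hq : q < 6) (ht : t < 5) :
    Sound p q t (stepOp p q t) := by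
  rcases Nat.eq_zero_or_pos t with rfl | h0
  · exact sound_passOp hpq hq
  · have e : stepOp p q t = fun S =>
        passOp p q (toggleOp p q t (Nat.lor S (mergeOp p q S))) := by
      funext S
      have hb : Nat.beq t 0 = false := by
        cases t with
        | zero => omega
        | succ t => rfl
      unfold stepOp
      rw [hb, cond_false, force_eq, force_eq]
    rw [e]
    have h1 := ((Sound.id p q).lor (sound_mergeOp hpq hq)).comp_right (sound_toggleOp hpq hq ht)
    exact h1.comp_left (sound_passOp hpq hq)

/-- The state set after the cells `cs` with the terminal labels `ts`. -/
noncomputable def run : List (ℕ × ℕ) → List ℕ → ℕ → ℕ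
  | c :: cs, t :: ts, S => run cs ts (stepOp c.1 c.2 t S)
  | _, _, S => S

/-- State `n` can be turned into `n'` by passing the cells `cs` with the terminal labels `ts`. -/
def Steps : List (ℕ × ℕ) → List ℕ → ℕ → ℕ → Prop
  | c :: cs, t :: ts, n, n' => ∃ m, Move c.1 c.2 t n m ∧ Steps cs ts m n'
  | _, _, n, n' => n = n'

theorem steps_of_testBit_run (cs : List (ℕ × ℕ)) (ts : List ℕ) (S n' : ℕ)
    (hcs : ∀ c ∈ cs, c.1 < c.2 ∧ c.2 < 6) (hts : ∀ t ∈ ts, t < 5)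
    (h : (run cs ts S).testBit n' = true) : ∃ n, S.testBit n = true ∧ Steps cs ts n n' := by
  induction cs generalizing ts S with
  | nil =>
    cases ts <;> exact ⟨n', h, rfl⟩
  | cons c cs ih =>
    cases ts with
    | nil => exact ⟨n', h, rfl⟩
    | cons t ts =>
      obtain ⟨m, hm, hs⟩ := ih ts _ (fun c hc => hcs c (List.mem_cons_of_mem _ hc))
        (fun t ht => hts t (List.mem_cons_of_mem _ ht)) h
      obtain ⟨hc1, hc2⟩ := hcs c List.mem_cons_self
      obtain ⟨n, hn, hmv⟩ := sound_stepOp hc1 hc2 (hts t List.mem_cons_self) _ _ hm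
      exact ⟨n, hn, m, hmv, hs⟩

/-! ### Soundness of the search up to relabelling -/

theorem perm_removeOne {x : ℕ} {l : List ℕ} (h : x ∈ l) : l.Perm (x :: removeOne x l) := by
  induction l with
  | nil => simp at h
  | cons y ys ih =>
    have e : removeOne x (y :: ys) = bif Nat.beq y x then ys else y :: removeOne x ys := rfl
    rcases hb : Nat.beq y x with _ | _
    · rw [e, hb, cond_false]
      have hyx : y ≠ x := by
        rintro rfl
        simp at hb
      have hx : x ∈ ys := by
        rcases List.mem_cons.1 h with h | h
        · exact absurd h.symm hyx
        · exact h
      exact ((ih hx).cons y).trans (List.Perm.swap _ _ _)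
    · rw [e, hb, cond_true, Nat.eq_of_beq_eq_true hb]

theorem allOf_eq_true {l : List ℕ} {f : ℕ → Bool} (h : allOf l f = true) {x : ℕ} (hx : x ∈ l) :
    f x = true := by
  induction l with
  | nil => simp at hx
  | cons y ys ih =>
    have e : allOf (y :: ys) f = bif f y then allOf ys f else false := rfl
    rw [e] at h
    rcases hb : f y with _ | _
    · rw [hb] at h
      exact absurd h (by simp)
    · rw [hb, cond_true] at h
      rcases List.mem_cons.1 hx with rfl | hx
      · exact hb
      · exact ih h hx

theorem search_cons (f : ℕ → Bool) (c : ℕ × ℕ) (cs : List (ℕ × ℕ)) (S : ℕ) (O A P : List ℕ)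
    (h : search f (c :: cs) S O A P = true) :
    (O.length + 2 * A.length + P.length ≤ cs.length →
      search f cs (stepOp c.1 c.2 0 S) O A P = true) ∧
    (∀ o O', O = o :: O' → search f cs (stepOp c.1 c.2 o S) O' A P = true) ∧
    (∀ a A', A = a :: A' → search f cs (stepOp c.1 c.2 a S) O A' (a :: P) = true) ∧
    ∀ x ∈ P, search f cs (stepOp c.1 c.2 x S) O A (removeOne x P) = true := by
  have key : ∀ {b₁ b₂ b₃ b₄ : Bool},
      (bif b₁ then bif b₂ then bif b₃ then b₄ else false else false else false) = true →
      b₁ = true ∧ b₂ = true ∧ b₃ = true ∧ b₄ = true := by decide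
  obtain ⟨h1, h2, h3, h4⟩ := key (show (bif _ then bif _ then bif _ then _ else false else false
    else false) = true from h)
  refine ⟨fun hl => ?_, ?_, ?_, fun x hx => ?_⟩
  · have hb : Nat.ble (Nat.add O.length (Nat.add (Nat.mul 2 A.length) P.length)) cs.length
        = true := by
      rw [Nat.ble_eq]
      change O.length + (2 * A.length + P.length) ≤ _
      omega
    rw [hb, cond_true, force_eq] at h1
    exact h1
  · rintro o O' rfl
    change force (stepOp c.1 c.2 o S) (fun S' => search f cs S' O' A P) = true at h2
    rwa [force_eq] at h2
  · rintro a A' rfl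
    change force (stepOp c.1 c.2 a S) (fun S' => search f cs S' O A' (a :: P)) = true at h3
    rwa [force_eq] at h3
  · have := allOf_eq_true h4 hx
    rwa [force_eq] at this

theorem map_swap_perm {o t : ℕ} {O : List ℕ} (hO : (o :: O).Nodup) (ht : t ∈ o :: O) :
    (((o :: O).erase t).map (Equiv.swap t o)).Perm O := by
  rcases List.mem_cons.1 ht with rfl | ht'
  · simp
  · have ho : o ∉ O := (List.nodup_cons.1 hO).1
    have hO' : O.Nodup := (List.nodup_cons.1 hO).2
    have hto : t ≠ o := fun h => ho (h ▸ ht')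
    rw [List.erase_cons_tail (by simpa using hto.symm), List.map_cons, Equiv.swap_apply_right]
    have : (O.erase t).map (Equiv.swap t o) = O.erase t := by
      conv_rhs => rw [← List.map_id (O.erase t)]
      refine List.map_congr_left fun x hx => ?_
      have hxt : x ≠ t := fun h => hO'.not_mem_erase (h ▸ hx)
      have hxo : x ≠ o := fun h => ho (h ▸ List.mem_of_mem_erase hx)
      exact Equiv.swap_apply_of_ne_of_ne hxt hxo
    rw [this]
    exact (List.perm_cons_erase ht').symm

theorem map_swap_of_notMem {o t : ℕ} {l : List ℕ} (ho : o ∉ l) (ht : t ∉ l) :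
    l.map (Equiv.swap t o) = l := by
  conv_rhs => rw [← List.map_id l]
  exact List.map_congr_left fun x hx => Equiv.swap_apply_of_ne_of_ne
    (fun h => ht (h ▸ hx)) (fun h => ho (h ▸ hx))

theorem filter_map_ne_zero {σ : ℕ → ℕ} (hσ : ∀ x, σ x = 0 ↔ x = 0) (l : List ℕ) :
    (l.map σ).filter (· ≠ 0) = (l.filter (· ≠ 0)).map σ := by
  induction l with
  | nil => rfl
  | cons x l ih =>
    by_cases hx : x = 0
    · have := (hσ x).2 hx
      simp_all
    · have : σ x ≠ 0 := fun h => hx ((hσ x).1 h)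
      simp_all

/-- The search introduces the labels of `O`, and those of `A`, only in order. An arbitrary placement
is brought into this form by swapping each newly met label t with the head of its list. That head
then leaves the list, so later swaps fix it, and the swaps compose to σ. -/
theorem search_sound (f : ℕ → Bool) (cs : List (ℕ × ℕ)) (S : ℕ) (O A P ts : List ℕ)
    (h : search f cs S O A P = true) (hnd : (0 :: (O ++ A ++ P)).Nodup)
    (hlen : ts.length = cs.length) (hts : (ts.filter (· ≠ 0)).Perm (O ++ (A ++ (A ++ P)))) :
    ∃ σ : Equiv.Perm ℕ, (∀ x, x ∉ O → x ∉ A → σ x = x) ∧ (∀ x ∈ O, σ x ∈ O) ∧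
      (∀ x ∈ A, σ x ∈ A) ∧ f (run cs (ts.map σ) S) = true := by
  induction cs generalizing S O A P ts with
  | nil =>
    rw [List.length_nil, List.length_eq_zero_iff] at hlen
    subst hlen
    exact ⟨1, fun _ _ _ => rfl, fun _ h => h, fun _ h => h, h⟩
  | cons c cs ih =>
    obtain ⟨t, ts, rfl⟩ : ∃ t ts', ts = t :: ts' := by
      cases ts with
      | nil => simp at hlen
      | cons t ts => exact ⟨t, ts, rfl⟩
    have hlen' : ts.length = cs.length := by simpa using hlen
    obtain ⟨h1, h2, h3, h4⟩ := search_cons f c cs S O A P h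
    by_cases ht : t = 0
    · subst ht
      have hts' : (ts.filter (· ≠ 0)).Perm (O ++ (A ++ (A ++ P))) := by simpa using hts
      have hl : O.length + 2 * A.length + P.length ≤ cs.length := by
        have e1 := hts'.length_eq
        have e2 := List.length_filter_le (· ≠ 0) ts
        simp only [List.length_append] at e1
        omega
      obtain ⟨σ, hσ1, hσ2, hσ3, hσ4⟩ := ih _ O A P ts (h1 hl) hnd hlen' hts'
      have h0 : σ 0 = 0 := by
        rw [List.nodup_cons] at hnd
        exact hσ1 0 (fun h => hnd.1 (by simp [h])) (fun h => hnd.1 (by simp [h]))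
      refine ⟨σ, hσ1, hσ2, hσ3, ?_⟩
      rw [List.map_cons, h0]
      exact hσ4
    · have hts' : (t :: ts.filter (· ≠ 0)).Perm (O ++ (A ++ (A ++ P))) := by simpa [ht] using hts
      have hmem : t ∈ O ++ (A ++ (A ++ P)) := hts'.subset List.mem_cons_self
      have hnd0 := (List.nodup_cons.1 hnd).1
      have hnd' := (List.nodup_cons.1 hnd).2
      simp only [List.mem_append, not_or] at hnd0
      have hOA : ∀ x ∈ O, x ∉ A := fun x hx hx' =>
        (List.disjoint_of_nodup_append (List.nodup_append.1 hnd').1) hx hx'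
      have hOAP : ∀ x ∈ P, x ∉ O ∧ x ∉ A := fun x hx =>
        ⟨fun hx' => (List.disjoint_of_nodup_append hnd') (List.mem_append_left _ hx') hx,
          fun hx' => (List.disjoint_of_nodup_append hnd') (List.mem_append_right _ hx') hx⟩
      have hO : O.Nodup := (List.nodup_append.1 (List.nodup_append.1 hnd').1).1
      have hA : A.Nodup := (List.nodup_append.1 (List.nodup_append.1 hnd').1).2.1
      have swap_zero : ∀ o, o ≠ 0 → ∀ x, Equiv.swap t o x = 0 ↔ x = 0 := by
        intro o ho x
        have h0 : Equiv.swap t o 0 = 0 := Equiv.swap_apply_of_ne_of_ne (Ne.symm ht) ho.symm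
        constructor
        · intro hx
          exact (Equiv.swap t o).injective (hx.trans h0.symm)
        · rintro rfl
          exact h0
      have hcase : t ∈ O ∨ t ∈ A ∨ t ∈ P := by
        simp only [List.mem_append] at hmem
        tauto
      rcases hcase with htO | htA | htP
      · obtain ⟨o, O', rfl⟩ : ∃ o O', O = o :: O' := by
          cases O with
          | nil => simp at htO
          | cons o O' => exact ⟨o, O', rfl⟩
        have ho : o ∈ o :: O' := List.mem_cons_self
        have htA : t ∉ A := hOA t htO
        have htP : t ∉ P := fun h => (hOAP t h).1 htO
        have hoA : o ∉ A := hOA o ho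
        have hoP : o ∉ P := fun h => (hOAP o h).1 ho
        have ho0 : o ≠ 0 := fun h => hnd0.1.1 (h ▸ ho)
        have hrest : (ts.filter (· ≠ 0)).Perm ((o :: O').erase t ++ (A ++ (A ++ P))) := by
          have := hts'.erase t
          rwa [List.erase_cons_head, List.erase_append_left _ htO] at this
        have hrest' : ((ts.map (Equiv.swap t o)).filter (· ≠ 0)).Perm (O' ++ (A ++ (A ++ P))) := by
          rw [filter_map_ne_zero (swap_zero o ho0)]
          refine (hrest.map _).trans ?_
          simp only [List.map_append]
          rw [map_swap_of_notMem hoA htA, map_swap_of_notMem hoP htP]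
          exact (map_swap_perm hO htO).append_right _
        have hnd2 : (0 :: (O' ++ A ++ P)).Nodup := by
          refine hnd.sublist (List.Sublist.cons_cons _ ?_)
          simp only [List.append_assoc]
          exact (List.sublist_cons_self o O').append_right _
        obtain ⟨σ, hσ1, hσ2, hσ3, hσ4⟩ := ih _ O' A P _ (h2 o O' rfl) hnd2 (by simpa using hlen')
          hrest'
        have hoO' : o ∉ O' := (List.nodup_cons.1 hO).1
        refine ⟨σ * Equiv.swap t o, fun x hx hx' => ?_, fun x hx => ?_, fun x hx => ?_, ?_⟩
        · have hxo : x ≠ o := fun h => hx (h ▸ ho)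
          have hxt : x ≠ t := fun h => hx (h ▸ htO)
          rw [Equiv.Perm.mul_apply, Equiv.swap_apply_of_ne_of_ne hxt hxo]
          exact hσ1 x (fun h => hx (List.mem_cons_of_mem _ h)) hx'
        · rw [Equiv.Perm.mul_apply]
          have hy : Equiv.swap t o x ∈ o :: O' := by
            rcases eq_or_ne x t with rfl | hxt
            · rw [Equiv.swap_apply_left]; exact ho
            rcases eq_or_ne x o with rfl | hxo
            · rw [Equiv.swap_apply_right]; exact htO
            rwa [Equiv.swap_apply_of_ne_of_ne hxt hxo]
          rcases List.mem_cons.1 hy with h | h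
          · rw [h, hσ1 o hoO' hoA]; exact ho
          · exact List.mem_cons_of_mem _ (hσ2 _ h)
        · have hxt : x ≠ t := fun h => htA (h ▸ hx)
          have hxo : x ≠ o := fun h => hoA (h ▸ hx)
          rw [Equiv.Perm.mul_apply, Equiv.swap_apply_of_ne_of_ne hxt hxo]
          exact hσ3 x hx
        · rw [List.map_cons, Equiv.Perm.mul_apply, Equiv.swap_apply_left, hσ1 o hoO' hoA]
          have : ts.map (σ * Equiv.swap t o) = (ts.map (Equiv.swap t o)).map σ := by
            rw [List.map_map]; rfl
          rw [this]
          exact hσ4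
      · obtain ⟨a, A', rfl⟩ : ∃ a A', A = a :: A' := by
          cases A with
          | nil => simp at htA
          | cons a A' => exact ⟨a, A', rfl⟩
        have ha : a ∈ a :: A' := List.mem_cons_self
        have htO : t ∉ O := fun h => hOA t h htA
        have htP : t ∉ P := fun h => (hOAP t h).2 htA
        have haO : a ∉ O := fun h => hOA a h ha
        have haP : a ∉ P := fun h => (hOAP a h).2 ha
        have ha0 : a ≠ 0 := fun h => hnd0.1.2 (h ▸ ha)
        have haA' : a ∉ A' := (List.nodup_cons.1 hA).1
        have hrest : (ts.filter (· ≠ 0)).Perm (O ++ ((a :: A').erase t ++ ((a :: A') ++ P))) := by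
          have := hts'.erase t
          rwa [List.erase_cons_head, List.erase_append_right _ htO,
            List.erase_append_left _ htA] at this
        have hmapA : ((a :: A').map (Equiv.swap t a)).Perm (a :: A') := by
          have h1 := (List.perm_cons_erase htA).map (Equiv.swap t a)
          rw [List.map_cons (l := (a :: A').erase t), Equiv.swap_apply_left] at h1
          exact h1.trans ((map_swap_perm hA htA).cons a)
        have hrest' : ((ts.map (Equiv.swap t a)).filter (· ≠ 0)).Perm
            (O ++ (A' ++ (A' ++ a :: P))) := by
          rw [filter_map_ne_zero (swap_zero a ha0)]
          refine (hrest.map _).trans ?_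
          simp only [List.map_append]
          rw [map_swap_of_notMem haO htO, map_swap_of_notMem haP htP]
          refine List.Perm.append_left _ ((map_swap_perm hA htA).append ?_)
          refine (hmapA.append_right P).trans ?_
          exact List.perm_middle.symm
        have hnd2 : (0 :: (O ++ A' ++ a :: P)).Nodup := by
          refine (List.Perm.nodup_iff (List.Perm.cons 0 ?_)).1 hnd
          simp only [List.append_assoc]
          exact List.Perm.append_left _ List.perm_middle.symm
        obtain ⟨σ, hσ1, hσ2, hσ3, hσ4⟩ := ih _ O A' (a :: P) _ (h3 a A' rfl) hnd2
          (by simpa using hlen') hrest'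
        refine ⟨σ * Equiv.swap t a, fun x hx hx' => ?_, fun x hx => ?_, fun x hx => ?_, ?_⟩
        · have hxo : x ≠ a := fun h => hx' (h ▸ ha)
          have hxt : x ≠ t := fun h => hx' (h ▸ htA)
          rw [Equiv.Perm.mul_apply, Equiv.swap_apply_of_ne_of_ne hxt hxo]
          exact hσ1 x hx (fun h => hx' (List.mem_cons_of_mem _ h))
        · have hxt : x ≠ t := fun h => htO (h ▸ hx)
          have hxo : x ≠ a := fun h => haO (h ▸ hx)
          rw [Equiv.Perm.mul_apply, Equiv.swap_apply_of_ne_of_ne hxt hxo]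
          exact hσ2 x hx
        · rw [Equiv.Perm.mul_apply]
          have hy : Equiv.swap t a x ∈ a :: A' := by
            rcases eq_or_ne x t with rfl | hxt
            · rw [Equiv.swap_apply_left]; exact ha
            rcases eq_or_ne x a with rfl | hxo
            · rw [Equiv.swap_apply_right]; exact htA
            rwa [Equiv.swap_apply_of_ne_of_ne hxt hxo]
          rcases List.mem_cons.1 hy with h | h
          · rw [h, hσ1 a haO haA']; exact ha
          · exact List.mem_cons_of_mem _ (hσ3 _ h)
        · rw [List.map_cons, Equiv.Perm.mul_apply, Equiv.swap_apply_left, hσ1 a haO haA']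
          have : ts.map (σ * Equiv.swap t a) = (ts.map (Equiv.swap t a)).map σ := by
            rw [List.map_map]; rfl
          rw [this]
          exact hσ4
      · have hp := perm_removeOne htP
        have hrest : (ts.filter (· ≠ 0)).Perm (O ++ (A ++ (A ++ removeOne t P))) := by
          refine List.Perm.cons_inv (a := t) (hts'.trans ?_)
          have e : (O ++ (A ++ (A ++ t :: removeOne t P))).Perm
              (t :: (O ++ (A ++ (A ++ removeOne t P)))) := by
            simp only [← List.append_assoc]
            exact List.perm_middle
          refine List.Perm.trans ?_ e
          exact List.Perm.append_left _ (List.Perm.append_left _ (List.Perm.append_left _ hp))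
        have hnd2 : (0 :: (O ++ A ++ removeOne t P)).Nodup := by
          have := (List.Perm.nodup_iff (List.Perm.cons 0 (List.Perm.append_left (O ++ A) hp))).1 hnd
          refine this.sublist (List.Sublist.cons_cons _ ?_)
          exact (List.sublist_cons_self t _).append_left _
        obtain ⟨σ, hσ1, hσ2, hσ3, hσ4⟩ := ih _ O A _ ts (h4 t htP) hnd2 hlen' hrest
        refine ⟨σ, hσ1, hσ2, hσ3, ?_⟩
        rw [List.map_cons, hσ1 t (hOAP t htP).1 (hOAP t htP).2]
        exact hσ4

theorem testBit_coreFold {l : List ℕ} {f : ℕ → ℕ} {s n x : ℕ} (hx : x ∈ l)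
    (h : (coreFold l f s).testBit n = true) : (f x).testBit n = true := by
  induction l with
  | nil => simp at hx
  | cons y ys ih =>
    have e : coreFold (y :: ys) f s = Nat.land (f y) (coreFold ys f s) := rfl
    rw [e, testBit_land'] at h
    rcases List.mem_cons.1 hx with rfl | hx
    · exact h.1
    · exact ih hx h.2

theorem testBit_coreFrom (cs : List (ℕ × ℕ)) (S : ℕ) (l ts : List ℕ) (n : ℕ)
    (hlen : ts.length = cs.length) (hts : (ts.filter (· ≠ 0)).Perm l)
    (h : (coreFrom cs S l).testBit n = true) : (run cs ts S).testBit n = true := by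
  induction cs generalizing S l ts with
  | nil =>
    rw [List.length_nil, List.length_eq_zero_iff] at hlen
    subst hlen
    exact h
  | cons c cs ih =>
    obtain ⟨t, ts, rfl⟩ : ∃ t ts', ts = t :: ts' := by
      cases ts with
      | nil => simp at hlen
      | cons t ts => exact ⟨t, ts, rfl⟩
    have hlen' : ts.length = cs.length := by simpa using hlen
    have e : coreFrom (c :: cs) S l = Nat.land
        (bif Nat.ble l.length cs.length then force (stepOp c.1 c.2 0 S) fun S' => coreFrom cs S' l
          else Nat.sub (Nat.pow 2 15625) 1)
        (coreFold l (fun x => force (stepOp c.1 c.2 x S) fun S' => coreFrom cs S' (removeOne x l))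
          (Nat.sub (Nat.pow 2 15625) 1)) := rfl
    rw [e, testBit_land'] at h
    by_cases ht : t = 0
    · subst ht
      have hts' : (ts.filter (· ≠ 0)).Perm l := by simpa using hts
      have hb : Nat.ble l.length cs.length = true := by
        rw [Nat.ble_eq, ← hts'.length_eq, ← hlen']
        exact List.length_filter_le _ _
      rw [hb, cond_true, force_eq] at h
      exact ih _ l ts hlen' hts' h.1
    · have hts' : (t :: ts.filter (· ≠ 0)).Perm l := by simpa [ht] using hts
      have hmem : t ∈ l := hts'.subset List.mem_cons_self
      have := testBit_coreFold hmem h.2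
      rw [force_eq] at this
      exact ih _ _ ts hlen' ((hts'.trans (perm_removeOne hmem)).cons_inv) this

/-! ### Realizable exits of a quadrant and their symmetries -/

/-- The `3 × 3` grid with terminal labels `T` has an edge labelling, balanced at all vertices, in
which the edges leaving the rows have labels `r` and those leaving the columns have labels `b`. -/
def Realizes (T : ℕ → ℕ → ℕ) (r b : ℕ → ℕ) : Prop :=
  ∃ h v : ℕ → ℕ → ℕ, (∀ i < 3, h i 0 = 0 ∧ h i 3 = r i) ∧ (∀ j < 3, v 0 j = 0 ∧ v 3 j = b j) ∧
    ∀ i < 3, ∀ j < 3, Balanced (T i j) (v i j) (h i j) (v (i + 1) j) (h i (j + 1))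

/-- The labels of a quadrant, row by row. -/
def flat (T : ℕ → ℕ → ℕ) : List ℕ :=
  [T 0 0, T 0 1, T 0 2, T 1 0, T 1 1, T 1 2, T 2 0, T 2 1, T 2 2]

theorem digit_zero (x : ℕ) : digit 0 x = 0 := by simp [digit]

theorem realizes_of_steps {T : ℕ → ℕ → ℕ} {n : ℕ} (h : Steps cells (flat T) 0 n) :
    Realizes T (fun i => digit n (3 + i)) (fun j => digit n j) := by
  obtain ⟨n1, h1, n2, h2, n3, h3, n4, h4, n5, h5, n6, h6, n7, h7, n8, h8, n9, h9, rfl⟩ := h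
  obtain ⟨p1, q1⟩ := h1
  obtain ⟨p2, q2⟩ := h2
  obtain ⟨p3, q3⟩ := h3
  obtain ⟨p4, q4⟩ := h4
  obtain ⟨p5, q5⟩ := h5
  obtain ⟨p6, q6⟩ := h6
  obtain ⟨p7, q7⟩ := h7
  obtain ⟨p8, q8⟩ := h8
  obtain ⟨p9, q9⟩ := h9
  simp only at *
  let N : ℕ → ℕ := fun k => [0, n1, n2, n3, n4, n5, n6, n7, n8, n9].getD k 0
  -- The label left of cell (i, j) is digit 3 + i after the 3 i + j cells before it. The label above
  -- was written by cell (i - 1, j), hence is digit j after 3 (i - 1) + j + 1 cells.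
  refine ⟨fun i j => if j = 0 then 0 else digit (N (3 * i + j)) (3 + i),
    fun i j => if i = 0 then 0 else digit (N (3 * (i - 1) + j + 1)) j, ?_, ?_, ?_⟩
  · intro i hi
    interval_cases i <;> simp [N, p4, p5, p6, p7, p8, p9]
  · intro i hi
    interval_cases i <;> simp [N, p8, p9]
  · intro i hi j hj
    interval_cases i <;> interval_cases j <;>
      simp [p1, p2, p3, p4, p5, p6, p7, p8, digit_zero]
        at q1 q2 q3 q4 q5 q6 q7 q8 q9 <;>
      simp [N] <;> assumption

theorem Balanced.map {σ : ℕ → ℕ} (hσ : σ.Injective) (h0 : σ 0 = 0) {t u l d r : ℕ}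
    (h : Balanced t u l d r) : Balanced (σ t) (σ u) (σ l) (σ d) (σ r) := by
  intro k hk
  by_cases hk' : ∃ k', σ k' = k
  · obtain ⟨k', rfl⟩ := hk'
    have hk0 : k' ≠ 0 := fun h => hk (h ▸ h0)
    have e : ∀ x, hit (σ k') (σ x) = hit k' x := fun x => by
      unfold hit
      simp only [hσ.eq_iff]
    simp only [e]
    exact h k' hk0
  · have e : ∀ x, hit k (σ x) = 0 := fun x => if_neg fun h => hk' ⟨x, h⟩
    simp only [e]
    exact ⟨0, rfl⟩

theorem Realizes.map {σ : ℕ → ℕ} (hσ : σ.Injective) (h0 : σ 0 = 0) {T : ℕ → ℕ → ℕ} {r b : ℕ → ℕ}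
    (h : Realizes T r b) :
    Realizes (fun i j => σ (T i j)) (fun i => σ (r i)) (fun j => σ (b j)) := by
  obtain ⟨h, v, hh, hv, hb⟩ := h
  refine ⟨fun i j => σ (h i j), fun i j => σ (v i j), fun i hi => ?_, fun j hj => ?_,
    fun i hi j hj => (hb i hi j hj).map hσ h0⟩
  · exact ⟨(congrArg σ (hh i hi).1).trans h0, congrArg σ (hh i hi).2⟩
  · exact ⟨(congrArg σ (hv j hj).1).trans h0, congrArg σ (hv j hj).2⟩

theorem Balanced.transpose {t u l d r : ℕ} (h : Balanced t u l d r) : Balanced t l u r d := by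
  intro k hk
  have := h k hk
  rw [Nat.even_iff] at *
  omega

theorem Realizes.transpose {T : ℕ → ℕ → ℕ} {r b : ℕ → ℕ} (h : Realizes T r b) :
    Realizes (fun i j => T j i) b r := by
  obtain ⟨h, v, hh, hv, hb⟩ := h
  exact ⟨fun i j => v j i, fun i j => h j i, hv, hh, fun i hi j hj => (hb j hj i hi).transpose⟩

/-- The number of vertices with label `l` in a quadrant. -/
def cnt (T : ℕ → ℕ → ℕ) (l : ℕ) : ℕ := (flat T).count l

theorem cnt_transpose (T : ℕ → ℕ → ℕ) (l : ℕ) : cnt (fun i j => T j i) l = cnt T l := by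
  simp only [cnt, flat, List.count_cons, List.count_nil]
  omega

def IsLabelling (T : ℕ → ℕ → ℕ) : Prop := ∀ t ∈ flat T, t < 5

theorem IsLabelling.transpose {T : ℕ → ℕ → ℕ} (h : IsLabelling T) :
    IsLabelling fun i j => T j i := by
  intro t ht
  apply h t
  simp only [flat, List.mem_cons, List.not_mem_nil, or_false] at ht ⊢
  tauto

theorem flat_map (σ : ℕ → ℕ) (T : ℕ → ℕ → ℕ) : flat (fun i j => σ (T i j)) = (flat T).map σ := rfl

theorem cnt_map (σ : Equiv.Perm ℕ) (T : ℕ → ℕ → ℕ) (l : ℕ) :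
    cnt (fun i j => σ (T i j)) (σ l) = cnt T l := by
  rw [cnt, flat_map]
  exact List.count_map_of_injective _ _ σ.injective _

theorem cnt_map' (σ : Equiv.Perm ℕ) (T : ℕ → ℕ → ℕ) (l : ℕ) :
    cnt (fun i j => σ (T i j)) l = cnt T (σ.symm l) := by
  rw [← cnt_map σ T, Equiv.apply_symm_apply]

/-- A permutation of the labels `1, 2, 3, 4`. -/
def IsRelabelling (σ : Equiv.Perm ℕ) : Prop := ∀ x, x ∉ [1, 2, 3, 4] → σ x = x

theorem IsRelabelling.zero {σ : Equiv.Perm ℕ} (h : IsRelabelling σ) : σ 0 = 0 := h 0 (by simp)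

theorem IsRelabelling.mem {σ : Equiv.Perm ℕ} (h : IsRelabelling σ) {x : ℕ} (hx : x ∈ [1, 2, 3, 4]) :
    σ x ∈ [1, 2, 3, 4] := by
  by_contra hn
  have := σ.injective (h _ hn)
  rw [this] at hn
  exact hn hx

theorem IsRelabelling.symm {σ : Equiv.Perm ℕ} (h : IsRelabelling σ) : IsRelabelling σ.symm := by
  intro x hx
  rw [Equiv.symm_apply_eq]
  exact (h x hx).symm

theorem IsRelabelling.mul {σ τ : Equiv.Perm ℕ} (h : IsRelabelling σ) (h' : IsRelabelling τ) :
    IsRelabelling (σ * τ) := by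
  intro x hx
  rw [Equiv.Perm.mul_apply, h' x hx, h x hx]

theorem mem_labels {x : ℕ} : x ∈ [1, 2, 3, 4] ↔ x ≠ 0 ∧ x < 5 := by
  simp only [List.mem_cons, List.not_mem_nil, or_false]
  omega

theorem IsRelabelling.map {σ : Equiv.Perm ℕ} (h : IsRelabelling σ) {T : ℕ → ℕ → ℕ}
    (hT : IsLabelling T) : IsLabelling fun i j => σ (T i j) := by
  intro t ht
  rw [flat_map, List.mem_map] at ht
  obtain ⟨x, hx, rfl⟩ := ht
  by_cases h0 : x = 0
  · rw [h0, h.zero]; norm_num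
  · exact (mem_labels.1 (h.mem (mem_labels.2 ⟨h0, hT x hx⟩))).2

theorem exists_perm_map_eq {l l' : List ℕ} (h : l.Perm l') (hl : l.Nodup) :
    ∃ σ : Equiv.Perm ℕ, l.map σ = l' ∧ ∀ x, x ∉ l → σ x = x := by
  induction h with
  | nil => exact ⟨1, rfl, fun _ _ => rfl⟩
  | cons a h ih =>
    obtain ⟨ha, hl⟩ := List.nodup_cons.1 hl
    obtain ⟨σ, h1, h2⟩ := ih hl
    exact ⟨σ, by rw [List.map_cons, h1, h2 a ha], fun x hx => h2 x fun h => hx (by simp [h])⟩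
  | swap a b l =>
    simp only [List.nodup_cons, List.mem_cons, not_or] at hl
    refine ⟨Equiv.swap a b, ?_, fun x hx => ?_⟩
    · rw [List.map_cons, List.map_cons, Equiv.swap_apply_left, Equiv.swap_apply_right,
        map_swap_of_notMem hl.1.2 hl.2.1]
    · simp only [List.mem_cons, not_or] at hx
      exact Equiv.swap_apply_of_ne_of_ne hx.2.1 hx.1
  | trans h h' ih ih' =>
    obtain ⟨σ, h1, h2⟩ := ih hl
    obtain ⟨τ, h3, h4⟩ := ih' (h.nodup_iff.1 hl)
    refine ⟨τ * σ, ?_, fun x hx => ?_⟩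
    · rw [← h3, ← h1, List.map_map]; rfl
    · rw [Equiv.Perm.mul_apply, h2 x hx]
      exact h4 x fun hx' => hx (h.mem_iff.2 hx')

def column (m a i : ℕ) : ℕ := if i ≤ m then 1 else if i ≤ m + a then 2 else 0

theorem columns_eq (m a : ℕ) :
    columns m a = (column m a 1, column m a 2, column m a 3, column m a 4) := by
  have h : ∀ i j, Nat.ble i j = decide (i ≤ j) := fun i j => by
    rw [Bool.eq_iff_iff, Nat.ble_eq, decide_eq_true_iff]
  simp only [columns, column, h, Bool.cond_decide]
  rfl

theorem filter_perm_of_count {l l' : List ℕ} (h : ∀ x ≠ 0, l.count x = l'.count x) (h' : 0 ∉ l') :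
    (l.filter (· ≠ 0)).Perm l' := by
  rw [List.perm_iff_count]
  intro x
  by_cases hx : x = 0
  · subst hx
    rw [List.count_eq_zero_of_not_mem h', List.count_eq_zero_of_not_mem (by simp)]
  · rw [← h x hx]
    exact List.count_filter (by simpa using hx)

/-- Two renamings are composed: τ sorts labels by multiplicity, making the single ones 1, …, m and
the double ones the next a; σ comes from the search and preserves both ranges. -/
theorem exists_relabelling_of_check {m a : ℕ} (hc : check m a = true) {T : ℕ → ℕ → ℕ}
    (hT : IsLabelling T) (hm : ([1, 2, 3, 4].filter fun l => cnt T l = 1).length = m)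
    (ha : ([1, 2, 3, 4].filter fun l => cnt T l = 2).length = a)
    (hle : ∀ l ∈ [1, 2, 3, 4], cnt T l ≤ 2) :
    ∃ σ : Equiv.Perm ℕ, IsRelabelling σ ∧
      (∀ l ∈ [1, 2, 3, 4], cnt (fun i j => σ (T i j)) l = column m a l) ∧
      passesAll (testsFor m a) (run cells (flat fun i j => σ (T i j)) 1) = true := by
  set L₁ := [1, 2, 3, 4].filter fun l => cnt T l = 1 with hL₁
  set L₂ := [1, 2, 3, 4].filter fun l => cnt T l = 2 with hL₂
  set L₀ := [1, 2, 3, 4].filter fun l => cnt T l = 0 with hL₀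
  have hnd : [1, 2, 3, 4].Nodup := by decide
  have hnd₁ : L₁.Nodup := hnd.filter _
  have hnd₂ : L₂.Nodup := hnd.filter _
  have hnd₀ : L₀.Nodup := hnd.filter _
  have hnd' : (L₁ ++ (L₂ ++ L₀)).Nodup := by
    rw [List.nodup_append, List.nodup_append]
    refine ⟨hnd₁, ⟨hnd₂, hnd₀, fun x hx y hy => ?_⟩, fun x hx y hy => ?_⟩
    · simp only [hL₂, hL₀, List.mem_filter, decide_eq_true_iff] at hx hy
      rintro rfl
      omega
    · simp only [hL₁, hL₂, hL₀, List.mem_append, List.mem_filter, decide_eq_true_iff] at hx hy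
      rintro rfl
      omega
  have hperm : (L₁ ++ (L₂ ++ L₀)).Perm [1, 2, 3, 4] := by
    rw [List.perm_ext_iff_of_nodup hnd' hnd]
    intro x
    simp only [hL₁, hL₂, hL₀, List.mem_append, List.mem_filter, decide_eq_true_iff]
    refine ⟨fun h => ?_, fun h => ?_⟩
    · tauto
    · have := hle x h
      have : cnt T x = 1 ∨ cnt T x = 2 ∨ cnt T x = 0 := by omega
      tauto
  obtain ⟨τ, hτ, hτ'⟩ := exists_perm_map_eq hperm hnd'
  have hτr : IsRelabelling τ := fun x hx => hτ' x fun h => hx (hperm.mem_iff.1 h)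
  have hlen : m + (a + L₀.length) = 4 := by
    have := hperm.length_eq
    simp only [List.length_append, List.length_cons, List.length_nil] at this
    omega
  have hsplit : ([1, 2, 3, 4] : List ℕ) =
      List.range' 1 m ++ (List.range' (m + 1) a ++ List.range' (m + a + 1) L₀.length) := by
    have e1 : List.range' 1 m ++ List.range' (m + 1) a = List.range' 1 (m + a) := by
      rw [add_comm m 1, List.range'_append_1]
    rw [← List.append_assoc, e1, show m + a + 1 = 1 + (m + a) by omega, List.range'_append_1,
      show m + a + L₀.length = 4 by omega]
    rfl
  rw [hsplit, List.map_append, List.map_append] at hτ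
  obtain ⟨hτ₁, hτ₂⟩ := List.append_inj hτ (by simp [hm])
  obtain ⟨hτ₂, hτ₃⟩ := List.append_inj hτ₂ (by simp [ha])
  have hcol : ∀ x, x ≠ 0 → cnt (fun i j => τ (T i j)) x = column m a x := by
    intro x hx
    unfold column
    have hτx : τ (τ.symm x) = x := τ.apply_symm_apply x
    have hback : ∀ L : List ℕ, x ∈ L.map τ → τ.symm x ∈ L := by
      intro L h
      obtain ⟨y, hy, rfl⟩ := List.mem_map.1 h
      rwa [τ.symm_apply_apply]
    rw [cnt_map']
    split_ifs with h1 h2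
    · have := hback L₁ (by rw [hτ₁, List.mem_range'_1]; omega)
      simpa [hL₁] using (List.mem_filter.1 this).2
    · have := hback L₂ (by rw [hτ₂, List.mem_range'_1]; omega)
      simpa [hL₂] using (List.mem_filter.1 this).2
    · by_cases h5 : x < 5
      · have := hback L₀ (by rw [hτ₃, List.mem_range'_1]; omega)
        simpa [hL₀] using (List.mem_filter.1 this).2
      · have : τ.symm x = x := hτr.symm x (by rw [mem_labels]; omega)
        rw [this]
        exact List.count_eq_zero_of_not_mem fun h => h5 (hT x h)
  have hfp : ((flat fun i j => τ (T i j)).filter (· ≠ 0)).Perm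
      (List.range' 1 m ++ (List.range' (m + 1) a ++ (List.range' (m + 1) a ++ []))) := by
    refine filter_perm_of_count (fun x hx => ?_) (by simp)
    have := hcol x hx
    rw [cnt] at this
    rw [this]
    have e : ∀ s n, (List.range' s n).count x = if s ≤ x ∧ x < s + n then 1 else 0 := fun s n => by
      rw [List.Nodup.count List.nodup_range']
      simp only [List.mem_range'_1]
    simp only [List.count_append, List.count_nil, e, column]
    split_ifs <;> omega
  have hs : search (passesAll (testsFor m a)) cells 1 (List.range' 1 m) (List.range' (m + 1) a) []
      = true := by
    rw [← hc, check, forceLists_eq]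
  obtain ⟨σ, h1, h2, h3, h4⟩ := search_sound _ _ _ _ _ _ _ hs (by
    have : (0 :: (List.range' 1 m ++ List.range' (m + 1) a ++ [])) = List.range' 0 (m + a + 1) := by
      rw [List.append_nil, add_comm m 1, List.range'_append_1, List.range'_succ]
    rw [this]
    exact List.nodup_range') rfl hfp
  refine ⟨σ * τ, IsRelabelling.mul (fun x hx => h1 x ?_ ?_) hτr, fun l hl => ?_, h4⟩
  · rw [mem_labels] at hx
    rw [List.mem_range'_1]; omega
  · rw [mem_labels] at hx
    rw [List.mem_range'_1]; omega
  · have hl0 := (mem_labels.1 hl).1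
    have e : cnt (fun i j => (σ * τ) (T i j)) l = cnt (fun i j => τ (T i j)) (σ.symm l) :=
      cnt_map' σ (fun i j => τ (T i j)) l
    -- An injective self-map of a finite set is onto, so σ also reflects membership.
    have hb : ∀ L : List ℕ, (∀ x ∈ L, σ x ∈ L) → ∀ x, σ x ∈ L → x ∈ L := by
      intro L hL x hx
      have hinj : Set.InjOn σ (L.toFinset : Set ℕ) := σ.injective.injOn
      have hmaps : Set.MapsTo σ (L.toFinset : Set ℕ) (L.toFinset : Set ℕ) := fun y hy => by
        simpa using hL y (by simpa using hy)
      obtain ⟨y, hy, hxy⟩ := Finset.surjOn_of_injOn_of_card_le σ hmaps hinj le_rfl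
        (show σ x ∈ (L.toFinset : Set ℕ) by simpa using hx)
      rw [← σ.injective hxy]
      simpa using hy
    have hσl : σ (σ.symm l) = l := σ.apply_symm_apply l
    have hs0 : σ.symm l ≠ 0 := by
      intro h0
      have h00 : σ 0 = 0 := h1 0 (by simp) (by simp)
      rw [h0, h00] at hσl
      exact hl0 hσl.symm
    rw [e, hcol _ hs0]
    by_cases hlm : l ∈ List.range' 1 m
    · have := hb _ h2 (σ.symm l) (by rwa [hσl])
      rw [List.mem_range'_1] at this hlm
      unfold column
      rw [if_pos (by omega), if_pos (by omega)]
    · by_cases hla : l ∈ List.range' (m + 1) a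
      · have := hb _ h3 (σ.symm l) (by rwa [hσl])
        rw [List.mem_range'_1] at this hla
        unfold column
        rw [if_neg (by omega), if_pos (by omega), if_neg (by omega), if_pos (by omega)]
      · have : σ.symm l = l := by
          rw [Equiv.symm_apply_eq]
          exact (h1 l hlm hla).symm
        rw [this]

/-! ### What a passed test says about quadrants -/

theorem passes_of_passesAll {tests : List (List ℕ)} {S : ℕ} (h : passesAll tests S = true)
    {t : List ℕ} (ht : t ∈ tests) : passes S t = true := by
  induction tests with
  | nil => simp at ht
  | cons u us ih =>
    have e : passesAll (u :: us) S = bif passes S u then passesAll us S else false := rfl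
    rw [e] at h
    rcases hb : passes S u with _ | _
    · rw [hb] at h
      exact absurd h (by simp)
    · rw [hb, cond_true] at h
      rcases List.mem_cons.1 ht with rfl | ht
      · exact hb
      · exact ih h ht

theorem hits_cons (S d : ℕ) (ds : List ℕ) :
    hits S (d :: ds) = if Nat.land S d = 0 then hits S ds else hits S ds + 1 := by
  have e : hits S (d :: ds) = bif Nat.beq (Nat.land S d) 0 then hits S ds
    else Nat.add (hits S ds) 1 := rfl
  have h : ∀ i j, Nat.beq i j = decide (i = j) := fun i j => by
    rw [Bool.eq_iff_iff, decide_eq_true_iff, Nat.beq_eq]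
  rw [e, h, Bool.cond_decide]

theorem hits_le_countP {α : Type} (S : ℕ) (l : List α) (g : α → ℕ) (p : α → Prop)
    [DecidablePred p] (h : ∀ x ∈ l, Nat.land S (g x) ≠ 0 → p x) :
    hits S (l.map g) ≤ l.countP (fun x => decide (p x)) := by
  induction l with
  | nil => exact le_rfl
  | cons x l ih =>
    have ih := ih fun y hy => h y (List.mem_cons_of_mem _ hy)
    have hx := h x List.mem_cons_self
    rw [List.map_cons, hits_cons, List.countP_cons]
    by_cases h0 : Nat.land S (g x) = 0
    · rw [if_pos h0]
      exact ih.trans (Nat.le_add_right _ _)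
    · rw [if_neg h0, if_pos (by simpa using hx h0)]
      exact Nat.add_le_add_right ih 1

theorem exists_testBit_of_land_ne_zero {x y : ℕ} (h : Nat.land x y ≠ 0) :
    ∃ n, x.testBit n = true ∧ y.testBit n = true := by
  by_contra hn
  refine h (Nat.eq_of_testBit_eq fun i => ?_)
  rw [Nat.zero_testBit]
  by_contra hi
  exact hn ⟨i, (testBit_land' x y i).1 (by simpa using hi)⟩

theorem testBit_slice {C k b : ℕ} (h : (slice C k).testBit b = true) :
    b < 125 ∧ C.testBit (125 * k + b) = true := by
  rw [slice, testBit_land', testBit_shr] at h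
  obtain ⟨h1, h2⟩ := h
  have h2' : (2 ^ 125 - 1).testBit b = true := h2
  rw [Nat.testBit_two_pow_sub_one, decide_eq_true_iff] at h2'
  exact ⟨h2', h1⟩

theorem testBit_transfer {C k k' n : ℕ} (h : (transfer C k k').testBit n = true) :
    ∃ b < 125, n = 125 * k' + b ∧ C.testBit (125 * k + b) = true := by
  rw [transfer, testBit_shl] at h
  obtain ⟨h1, h2⟩ := h
  change 125 * k' ≤ n at h1
  obtain ⟨h3, h4⟩ := testBit_slice h2
  exact ⟨_, h3, (Nat.add_sub_cancel' h1).symm, h4⟩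

theorem digit_low {k b j : ℕ} (hb : b < 125) (hj : j < 3) : digit (125 * k + b) j = digit b j := by
  unfold digit
  interval_cases j <;> norm_num <;> omega

theorem digit_high {k b : ℕ} (_hb : b < 125) (i : ℕ) :
    digit (125 * k + b) (3 + i) = digit k i := by
  unfold digit
  rw [pow_add, ← Nat.div_div_eq_div_mul]
  congr 2
  norm_num
  omega

theorem Realizes.congr {T : ℕ → ℕ → ℕ} {r b r' b' : ℕ → ℕ} (h : Realizes T r b)
    (hr : ∀ i < 3, r i = r' i) (hb : ∀ j < 3, b j = b' j) : Realizes T r' b' := by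
  obtain ⟨h, v, hh, hv, hc⟩ := h
  exact ⟨h, v, fun i hi => ⟨(hh i hi).1, (hh i hi).2.trans (hr i hi)⟩,
    fun j hj => ⟨(hv j hj).1, (hv j hj).2.trans (hb j hj)⟩, hc⟩

theorem realizes_of_testBit {T : ℕ → ℕ → ℕ} (hT : IsLabelling T) {k b : ℕ} (hb : b < 125)
    (h : (run cells (flat T) 1).testBit (125 * k + b) = true) :
    Realizes T (digit k) (digit b) := by
  obtain ⟨n, hn, hs⟩ := steps_of_testBit_run _ _ _ _ (by decide) hT h
  -- The initial mask 1 contains only the state 0: no label enters across the outer border.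
  have hn0 : n = 0 := by
    by_contra h0
    rw [Nat.testBit_one_eq_true_iff_self_eq_zero] at hn
    exact h0 hn
  subst hn0
  exact (realizes_of_steps hs).congr (fun i _ => digit_high hb i) fun j hj => digit_low hb hj

theorem realizes_of_testBit_core {T : ℕ → ℕ → ℕ} (hT : IsLabelling T) {l : List ℕ}
    (hl : ((flat T).filter (· ≠ 0)).Perm l) {k b : ℕ} (hb : b < 125)
    (h : (core l).testBit (125 * k + b) = true) : Realizes T (digit k) (digit b) :=
  realizes_of_testBit hT hb (testBit_coreFrom _ _ _ _ _ rfl hl h)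

def Triple.get (x : Triple) : ℕ → ℕ
  | 0 => x.1
  | 1 => x.2.1
  | _ => x.2.2

theorem digit_code {x : Triple} (h1 : x.1 < 5) (h2 : x.2.1 < 5) (h3 : x.2.2 < 5) {i : ℕ}
    (hi : i < 3) : digit x.code i = x.get i := by
  have e : x.code = x.1 + 5 * (x.2.1 + 5 * x.2.2) := rfl
  rw [e]
  unfold digit
  interval_cases i <;> simp only [Triple.get] <;> omega

/-- The two quadrants of a half of the grid can be completed with the exits `k`. -/
def HalfRealizes (T₁ T₂ : ℕ → ℕ → ℕ) (k : Triple × Triple) : Prop :=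
  ∃ b, Realizes T₁ k.1.get b ∧ Realizes T₂ k.2.get b

theorem HalfRealizes.swap {T₁ T₂ : ℕ → ℕ → ℕ} {k : Triple × Triple} (h : HalfRealizes T₁ T₂ k) :
    HalfRealizes T₂ T₁ k.swap := by
  obtain ⟨b, h1, h2⟩ := h
  exact ⟨b, h2, h1⟩

def Triple.map (σ : ℕ → ℕ) (x : Triple) : Triple := (σ x.1, σ x.2.1, σ x.2.2)

theorem Triple.get_map (σ : ℕ → ℕ) (x : Triple) (i : ℕ) : (x.map σ).get i = σ (x.get i) := by
  unfold Triple.get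
  split <;> rfl

theorem HalfRealizes.unmap {σ : Equiv.Perm ℕ} (h0 : σ 0 = 0) {T₁ T₂ : ℕ → ℕ → ℕ}
    {k : Triple × Triple}
    (h : HalfRealizes (fun i j => σ (T₁ i j)) (fun i j => σ (T₂ i j)) k) :
    HalfRealizes T₁ T₂ (k.map (Triple.map σ.symm) (Triple.map σ.symm)) := by
  have h0' : σ.symm 0 = 0 := by rw [Equiv.symm_apply_eq, h0]
  obtain ⟨b, h1, h2⟩ := h
  refine ⟨fun j => σ.symm (b j), ?_, ?_⟩
  · have := h1.map σ.symm.injective h0'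
    simp only [Equiv.symm_apply_apply] at this
    exact this.congr (fun i _ => (Triple.get_map _ _ _).symm) fun _ _ => rfl
  · have := h2.map σ.symm.injective h0'
    simp only [Equiv.symm_apply_apply] at this
    exact this.congr (fun i _ => (Triple.get_map _ _ _).symm) fun _ _ => rfl

theorem spread_map {σ : ℕ → ℕ} (h0 : σ 0 = 0) (l : List ℕ) (hl : l.length ≤ 4) :
    spread (l.map σ) = (spread l).map (Triple.map σ) (Triple.map σ) := by
  rcases l with _ | ⟨a, _ | ⟨b, _ | ⟨c, _ | ⟨d, _ | ⟨e, l⟩⟩⟩⟩⟩ <;>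
    simp_all [spread, Triple.map]

theorem patterns_map {σ : ℕ → ℕ} (h0 : σ 0 = 0) (l : List ℕ) (hl : l.length ≤ 4) :
    patterns (l.map σ) = (patterns l).map (Prod.map (Triple.map σ) (Triple.map σ)) := by
  rw [patterns, patterns, ← List.map_permutations', List.flatMap_map, List.map_flatMap]
  refine List.flatMap_congr fun o ho => ?_
  have : o.length ≤ 4 := by
    rwa [(List.mem_permutations'.1 ho).length_eq]
  rw [spread_map h0 o this]
  rfl

theorem patterns_perm {l l' : List ℕ} (h : l.Perm l') : (patterns l).Perm (patterns l') :=
  h.permutations'.flatMap_right _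

/-- This is why `patterns` takes each arrangement together with its swap: the fuller quadrant of a
half may then be called the first. -/
theorem patterns_swap_perm (l : List ℕ) : ((patterns l).map Prod.swap).Perm (patterns l) := by
  rw [patterns, List.map_flatMap]
  refine List.Perm.flatMap_left _ fun o _ => ?_
  exact List.Perm.swap _ _ _

theorem lt_of_mem_patterns {l : List ℕ} (hl : ∀ x ∈ l, x < 5) {k : Triple × Triple}
    (hk : k ∈ patterns l) :
    (k.1.1 < 5 ∧ k.1.2.1 < 5 ∧ k.1.2.2 < 5) ∧ k.2.1 < 5 ∧ k.2.2.1 < 5 ∧ k.2.2.2 < 5 := by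
  rw [patterns, List.mem_flatMap] at hk
  obtain ⟨o, ho, hk⟩ := hk
  have ho' : ∀ x ∈ o, x < 5 := fun x hx => hl x ((List.mem_permutations'.1 ho).subset hx)
  simp only [List.mem_cons, List.not_mem_nil, or_false] at hk
  rcases o with _ | ⟨a, _ | ⟨b, _ | ⟨c, _ | ⟨d, _ | ⟨e, l⟩⟩⟩⟩⟩ <;>
    rcases hk with rfl | rfl <;> clear ho <;> simp_all [spread]

/-- The number of terminals in a quadrant. -/
def terminals (T : ℕ → ℕ → ℕ) : ℕ := ([1, 2, 3, 4].map (cnt T)).sum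

theorem IsRelabelling.perm {σ : Equiv.Perm ℕ} (h : IsRelabelling σ) :
    ([1, 2, 3, 4].map σ).Perm [1, 2, 3, 4] := by
  have hnd : [1, 2, 3, 4].Nodup := by decide
  rw [List.perm_ext_iff_of_nodup (hnd.map σ.injective) hnd]
  intro x
  rw [List.mem_map]
  refine ⟨?_, fun hx => ⟨σ.symm x, h.symm.mem hx, σ.apply_symm_apply x⟩⟩
  rintro ⟨y, hy, rfl⟩
  exact h.mem hy

theorem terminals_map {σ : Equiv.Perm ℕ} (h : IsRelabelling σ) (T : ℕ → ℕ → ℕ) :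
    terminals (fun i j => σ (T i j)) = terminals T := by
  have e : cnt (fun i j => σ (T i j)) = cnt T ∘ σ.symm := funext fun l => cnt_map' σ T l
  rw [terminals, e, ← List.map_map]
  exact (h.symm.perm.map _).sum_eq

theorem terminals_transpose (T : ℕ → ℕ → ℕ) : terminals (fun i j => T j i) = terminals T := by
  rw [terminals, show cnt (fun i j => T j i) = cnt T from funext (cnt_transpose T), terminals]

theorem length_filter_add {f : ℕ → ℕ} (l : List ℕ) (hf : ∀ x ∈ l, f x ≤ 2) :
    (l.filter fun x => f x = 1).length + 2 * (l.filter fun x => f x = 2).length = (l.map f).sum ∧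
      (l.filter fun x => f x = 1).length + (l.filter fun x => f x = 2).length ≤ l.length := by
  induction l with
  | nil => exact ⟨rfl, le_rfl⟩
  | cons x l ih =>
    obtain ⟨h1, h2⟩ := ih fun y hy => hf y (List.mem_cons_of_mem _ hy)
    have hx := hf x List.mem_cons_self
    simp only [List.filter_cons, List.map_cons, List.sum_cons, List.length_cons, decide_eq_true_eq]
    have : f x = 0 ∨ f x = 1 ∨ f x = 2 := by omega
    rcases this with h | h | h <;> simp [h] <;> omega

/-- The labels that occur exactly once in the half of the grid with the given quadrants. -/
def crossings (T₁ T₂ : ℕ → ℕ → ℕ) : List ℕ :=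
  [1, 2, 3, 4].filter fun l => cnt T₁ l + cnt T₂ l = 1

theorem crossings_map {σ : Equiv.Perm ℕ} (h : IsRelabelling σ) (T₁ T₂ : ℕ → ℕ → ℕ) :
    ((crossings (fun i j => σ (T₁ i j)) fun i j => σ (T₂ i j)).map σ.symm).Perm
      (crossings T₁ T₂) := by
  have e : crossings (fun i j => σ (T₁ i j)) (fun i j => σ (T₂ i j)) =
      [1, 2, 3, 4].filter ((fun l => decide (cnt T₁ l + cnt T₂ l = 1)) ∘ σ.symm) := by
    unfold crossings
    congr 1
    funext l
    simp only [cnt_map', Function.comp_apply]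
  rw [e, ← List.filter_map]
  exact h.symm.perm.filter _

def roleOf (T₁ T₂ T₃ T₄ : ℕ → ℕ → ℕ) (l : ℕ) : Role := (cnt T₁ l, cnt T₂ l, cnt T₃ l, cnt T₄ l)

def rolesOf (T₁ T₂ T₃ T₄ : ℕ → ℕ → ℕ) : Roles :=
  (roleOf T₁ T₂ T₃ T₄ 1, roleOf T₁ T₂ T₃ T₄ 2, roleOf T₁ T₂ T₃ T₄ 3, roleOf T₁ T₂ T₃ T₄ 4)

theorem mem_product {f : ℕ → List Role} {m a : ℕ} {g : ℕ → Role}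
    (h : ∀ l ∈ [1, 2, 3, 4], g l ∈ f (column m a l)) :
    (g 1, g 2, g 3, g 4) ∈ product f (columns m a) := by
  rw [columns_eq]
  simp only [product, List.mem_flatMap, List.mem_map]
  exact ⟨_, h 1 (by simp), _, h 2 (by simp), _, h 3 (by simp), _, h 4 (by simp), rfl⟩

theorem flat_filter_perm {T : ℕ → ℕ → ℕ} (hT : IsLabelling T) :
    ((flat T).filter (· ≠ 0)).Perm (List.replicate (cnt T 1) 1 ++ (List.replicate (cnt T 2) 2 ++
      (List.replicate (cnt T 3) 3 ++ List.replicate (cnt T 4) 4))) := by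
  refine filter_perm_of_count (fun x hx => ?_) (by simp)
  simp only [List.count_append, List.count_replicate]
  by_cases h5 : x < 5
  · interval_cases x <;> simp_all [cnt]
  · have : ¬ x ∈ flat T := fun h => h5 (hT x h)
    rw [List.count_eq_zero_of_not_mem this]
    have : ∀ y < 5, (y == x) = false := fun y hy => by
      rw [beq_eq_false_iff_ne]; omega
    simp [this]

theorem labelsBy_crossing (T₁ T₂ T₃ T₄ : ℕ → ℕ → ℕ) :
    labelsBy (rolesOf T₁ T₂ T₃ T₄) crossing = crossings T₁ T₂ := by
  have e : ∀ l, crossing (roleOf T₁ T₂ T₃ T₄ l) = if cnt T₁ l + cnt T₂ l = 1 then 1 else 0 := by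
    intro l
    have h : ∀ i j, Nat.beq i j = decide (i = j) := fun i j => by
      rw [Bool.eq_iff_iff, decide_eq_true_iff, Nat.beq_eq]
    rw [crossing, h, Bool.cond_decide]
    rfl
  simp only [labelsBy, rolesOf, e, crossings]
  have e' : ∀ (p : ℕ → Bool) (x : ℕ) (l : List ℕ),
      (x :: l).filter p = List.replicate (if p x = true then 1 else 0) x ++ l.filter p := by
    intro p x l
    rw [List.filter_cons]
    split_ifs <;> simp
  rw [e', e', e', e']
  simp only [decide_eq_true_eq, List.filter_nil, List.append_nil]

/-! ### The kernel computations -/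

set_option maxRecDepth 100000 in
theorem check_2_0 : check 2 0 = true := by decide +kernel

set_option maxRecDepth 100000 in
theorem check_3_0 : check 3 0 = true := by decide +kernel

set_option maxRecDepth 100000 in
theorem check_4_0 : check 4 0 = true := by decide +kernel

set_option maxRecDepth 100000 in
theorem check_0_1 : check 0 1 = true := by decide +kernel

set_option maxRecDepth 100000 in
theorem check_1_1 : check 1 1 = true := by decide +kernel

set_option maxRecDepth 100000 in
theorem check_2_1 : check 2 1 = true := by decide +kernel

set_option maxRecDepth 100000 in
theorem check_3_1 : check 3 1 = true := by decide +kernel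

set_option maxRecDepth 100000 in
theorem check_0_2 : check 0 2 = true := by decide +kernel

set_option maxRecDepth 100000 in
theorem check_1_2 : check 1 2 = true := by decide +kernel

set_option maxRecDepth 100000 in
theorem check_2_2 : check 2 2 = true := by decide +kernel

set_option maxRecDepth 100000 in
theorem check_0_3 : check 0 3 = true := by decide +kernel

set_option maxRecDepth 100000 in
theorem check_1_3 : check 1 3 = true := by decide +kernel

set_option maxRecDepth 100000 in
theorem check_0_4 : check 0 4 = true := by decide +kernel

theorem check_eq_true {m a : ℕ} (h : m + a ≤ 4) (h' : 2 ≤ m + 2 * a) : check m a = true := by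
  have h1 : m ≤ 4 := by omega
  have h2 : a ≤ 4 := by omega
  -- At reducible transparency an alternative for the wrong pair fails at once instead of unfolding
  -- `check`.
  interval_cases m <;> interval_cases a <;> first
    | omega
    | with_reducible exact check_2_0
    | with_reducible exact check_3_0
    | with_reducible exact check_4_0
    | with_reducible exact check_0_1
    | with_reducible exact check_1_1
    | with_reducible exact check_2_1
    | with_reducible exact check_3_1
    | with_reducible exact check_0_2
    | with_reducible exact check_1_2
    | with_reducible exact check_2_2
    | with_reducible exact check_0_3
    | with_reducible exact check_1_3
    | with_reducible exact check_0_4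

/-! ### Halves with three to five terminals -/

theorem half_test_sound {T₁ T₂ : ℕ → ℕ → ℕ} (T₃ T₄ : ℕ → ℕ → ℕ) (h₁ : IsLabelling T₁)
    (h₂ : IsLabelling T₂)
    (h : passes (run cells (flat T₁) 1) (halfTest (rolesOf T₁ T₂ T₃ T₄)) = true)
    [DecidablePred (HalfRealizes T₁ T₂)] :
    threshold (terminals T₁ + terminals T₂) (patterns (crossings T₁ T₂)).length ≤
      (patterns (crossings T₁ T₂)).countP (HalfRealizes T₁ T₂) := by
  have ht : ∀ T : ℕ → ℕ → ℕ, terminals T = cnt T 1 + (cnt T 2 + (cnt T 3 + cnt T 4)) := fun T => by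
    simp [terminals]
  rw [halfTest, force_eq, labelsBy_crossing] at h
  have h' := Nat.le_of_ble_eq_true (show Nat.ble _ _ = true from h)
  have e : Nat.add (total (rolesOf T₁ T₂ T₃ T₄) fun r => r.1)
      (total (rolesOf T₁ T₂ T₃ T₄) fun r => r.2.1) = terminals T₁ + terminals T₂ := by
    rw [ht, ht]; rfl
  rw [e] at h'
  refine h'.trans (hits_le_countP _ _ _ _ fun k hk h0 => ?_)
  obtain ⟨⟨a1, a2, a3⟩, b1, b2, b3⟩ := lt_of_mem_patterns (fun x hx => by
    have := (mem_labels.1 (List.mem_filter.1 hx).1).2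
    exact this) hk
  obtain ⟨n, hn1, hn2⟩ := exists_testBit_of_land_ne_zero h0
  obtain ⟨b, hb, rfl, hn3⟩ := testBit_transfer hn2
  exact ⟨digit b, (realizes_of_testBit h₁ hb hn1).congr (fun i hi => digit_code a1 a2 a3 hi)
    fun _ _ => rfl, (realizes_of_testBit_core h₂ (flat_filter_perm h₂) hb hn3).congr
    (fun i hi => digit_code b1 b2 b3 hi) fun _ _ => rfl⟩

theorem exists_relabelling {T : ℕ → ℕ → ℕ} (hT : IsLabelling T)
    (hle : ∀ l ∈ [1, 2, 3, 4], cnt T l ≤ 2) (h2 : 2 ≤ terminals T) :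
    ∃ σ : Equiv.Perm ℕ, ∃ m a : ℕ, IsRelabelling σ ∧
      (∀ l ∈ [1, 2, 3, 4], cnt (fun i j => σ (T i j)) l = column m a l) ∧
      passesAll (testsFor m a) (run cells (flat fun i j => σ (T i j)) 1) = true := by
  obtain ⟨e1, e2⟩ := length_filter_add [1, 2, 3, 4] hle
  obtain ⟨σ, h⟩ := exists_relabelling_of_check
    (check_eq_true e2 (by rw [e1]; exact h2)) hT rfl rfl hle
  exact ⟨σ, _, _, h⟩

theorem mem_halfRoles {a b c : ℕ} (h : c = a) (ha : a ≤ 2) (hb : c + b ≤ 2) :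
    (c, b, 0, 0) ∈ halfRoles a := by
  subst h
  have : b ≤ 2 := by omega
  interval_cases c <;> interval_cases b <;> first | omega | decide

theorem column_le (m a l : ℕ) : column m a l ≤ 2 := by
  unfold column
  split_ifs <;> omega

def IsHalfLabelling (T₁ T₂ : ℕ → ℕ → ℕ) : Prop :=
  IsLabelling T₁ ∧ IsLabelling T₂ ∧ ∀ l ∈ [1, 2, 3, 4], cnt T₁ l + cnt T₂ l ≤ 2

theorem cnt_zero {l : ℕ} (hl : l ≠ 0) : cnt (fun _ _ => 0) l = 0 := by
  simp [cnt, flat, hl.symm]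

/-- The fuller quadrant has at least two terminals, so a renamed form of it was checked. The count
is carried back along σ⁻¹, which takes the patterns of the renamed half to those of the original
one. -/
theorem le_countP_of_le {T₁ T₂ : ℕ → ℕ → ℕ} (h : IsHalfLabelling T₁ T₂)
    (hle : terminals T₂ ≤ terminals T₁) (h3 : 3 ≤ terminals T₁ + terminals T₂)
    (h5 : terminals T₁ + terminals T₂ ≤ 5) [DecidablePred (HalfRealizes T₁ T₂)] :
    threshold (terminals T₁ + terminals T₂) (patterns (crossings T₁ T₂)).length ≤
      (patterns (crossings T₁ T₂)).countP (HalfRealizes T₁ T₂) := by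
  classical
  obtain ⟨hT₁, hT₂, hc⟩ := h
  obtain ⟨σ, m, a, hσ, hcol, hp⟩ := exists_relabelling hT₁
    (fun l hl => (Nat.le_add_right _ _).trans (hc l hl)) (by omega)
  set U₁ : ℕ → ℕ → ℕ := fun i j => σ (T₁ i j) with hU₁
  set U₂ : ℕ → ℕ → ℕ := fun i j => σ (T₂ i j) with hU₂
  -- The opposite half plays no part in this test and is taken to be empty.
  set Z : ℕ → ℕ → ℕ := fun _ _ => 0 with hZ
  have hn₁ : terminals U₁ = terminals T₁ := terminals_map hσ T₁
  have hn₂ : terminals U₂ = terminals T₂ := terminals_map hσ T₂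
  have hmem : rolesOf U₁ U₂ Z Z ∈ product halfRoles (columns m a) := by
    refine mem_product (g := roleOf U₁ U₂ Z Z) fun l hl => ?_
    have hl0 := (mem_labels.1 hl).1
    rw [roleOf, hZ, cnt_zero hl0]
    refine mem_halfRoles (hcol l hl) (column_le m a l) ?_
    rw [hU₁, hU₂, cnt_map', cnt_map']
    exact hc _ (hσ.symm.mem hl)
  have ht : ∀ T : ℕ → ℕ → ℕ, terminals T = cnt T 1 + (cnt T 2 + (cnt T 3 + cnt T 4)) := fun T => by
    simp [terminals]
  have e₁ : (total (rolesOf U₁ U₂ Z Z) fun r => r.1) = terminals T₁ := by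
    rw [← hn₁, ht]; rfl
  have e₂ : (total (rolesOf U₁ U₂ Z Z) fun r => r.2.1) = terminals T₂ := by
    rw [← hn₂, ht]; rfl
  have hhalf : isHalf (rolesOf U₁ U₂ Z Z) = true := by
    simp only [isHalf, e₁, e₂, Bool.and_eq_true, Nat.ble_eq, Nat.add_eq]
    exact ⟨hle, h3, h5⟩
  have hpass := passes_of_passesAll hp (t := halfTest (rolesOf U₁ U₂ Z Z))
    (List.mem_append_left _ (List.mem_map_of_mem (List.mem_filter.2 ⟨hmem, hhalf⟩)))
  have key := half_test_sound Z Z (hσ.map hT₁) (hσ.map hT₂) hpass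
  rw [hn₁, hn₂] at key
  have hlen : (crossings U₁ U₂).length ≤ 4 := List.length_filter_le _ _
  have hperm : ((patterns (crossings U₁ U₂)).map
      (Prod.map (Triple.map σ.symm) (Triple.map σ.symm))).Perm (patterns (crossings T₁ T₂)) := by
    rw [← patterns_map hσ.symm.zero _ hlen]
    exact patterns_perm (crossings_map hσ T₁ T₂)
  rw [← hperm.countP_eq, ← hperm.length_eq, List.length_map, List.countP_map]
  refine key.trans (List.countP_mono_left fun k _ hk => ?_)
  simp only [decide_eq_true_eq, Function.comp_apply] at hk ⊢
  exact hk.unmap hσ.zero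

theorem le_countP {T₁ T₂ : ℕ → ℕ → ℕ} (h : IsHalfLabelling T₁ T₂)
    (h3 : 3 ≤ terminals T₁ + terminals T₂)
    (h5 : terminals T₁ + terminals T₂ ≤ 5) [DecidablePred (HalfRealizes T₁ T₂)] :
    threshold (terminals T₁ + terminals T₂) (patterns (crossings T₁ T₂)).length ≤
      (patterns (crossings T₁ T₂)).countP (HalfRealizes T₁ T₂) := by
  classical
  rcases le_total (terminals T₂) (terminals T₁) with hle | hle
  · exact le_countP_of_le h hle h3 h5
  · have e : crossings T₂ T₁ = crossings T₁ T₂ := by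
      simp only [crossings, add_comm]
    have key := le_countP_of_le (T₁ := T₂) (T₂ := T₁)
      ⟨h.2.1, h.1, fun l hl => by rw [add_comm]; exact h.2.2 l hl⟩ hle
      (by rwa [add_comm]) (by rwa [add_comm])
    rw [e, add_comm] at key
    have hperm := patterns_swap_perm (crossings T₁ T₂)
    rw [← hperm.countP_eq (p := fun k => decide (HalfRealizes T₁ T₂ k)), List.countP_map]
    refine key.trans (List.countP_mono_left fun k _ hk => ?_)
    simp only [decide_eq_true_eq, Function.comp_apply] at hk ⊢
    exact hk.swap

/-! ### Joining the four quadrants -/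

/-- The quadrants, numbered north-west, south-west, north-east, south-east, can be completed
compatibly. -/
def Solvable (T₁ T₂ T₃ T₄ : ℕ → ℕ → ℕ) : Prop :=
  ∃ b b' r r' : ℕ → ℕ, Realizes T₁ r b ∧ Realizes T₂ r' b ∧ Realizes T₃ r b' ∧ Realizes T₄ r' b'

structure IsGridLabelling (T₁ T₂ T₃ T₄ : ℕ → ℕ → ℕ) : Prop where
  one : IsLabelling T₁
  two : IsLabelling T₂
  three : IsLabelling T₃
  four : IsLabelling T₄
  cnt_add : ∀ l ∈ [1, 2, 3, 4], cnt T₁ l + cnt T₂ l + cnt T₃ l + cnt T₄ l = 2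

variable {T₁ T₂ T₃ T₄ : ℕ → ℕ → ℕ}

theorem IsGridLabelling.mirror (h : IsGridLabelling T₁ T₂ T₃ T₄) : IsGridLabelling T₃ T₄ T₁ T₂ :=
  ⟨h.3, h.4, h.1, h.2, fun l hl => by have := h.5 l hl; omega⟩

theorem IsGridLabelling.flip (h : IsGridLabelling T₁ T₂ T₃ T₄) : IsGridLabelling T₂ T₁ T₄ T₃ :=
  ⟨h.2, h.1, h.4, h.3, fun l hl => by have := h.5 l hl; omega⟩

theorem IsGridLabelling.transpose (h : IsGridLabelling T₁ T₂ T₃ T₄) :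
    IsGridLabelling (fun i j => T₁ j i) (fun i j => T₃ j i) (fun i j => T₂ j i)
      fun i j => T₄ j i :=
  ⟨h.1.transpose, h.3.transpose, h.2.transpose, h.4.transpose, fun l hl => by
    simp only [cnt_transpose]; have := h.5 l hl; omega⟩

theorem Solvable.mirror (h : Solvable T₃ T₄ T₁ T₂) : Solvable T₁ T₂ T₃ T₄ := by
  obtain ⟨b, b', r, r', h1, h2, h3, h4⟩ := h
  exact ⟨b', b, r, r', h3, h4, h1, h2⟩

theorem Solvable.flip (h : Solvable T₂ T₁ T₄ T₃) : Solvable T₁ T₂ T₃ T₄ := by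
  obtain ⟨b, b', r, r', h1, h2, h3, h4⟩ := h
  exact ⟨b, b', r', r, h2, h1, h4, h3⟩

theorem Solvable.transpose (h : Solvable (fun i j => T₁ j i) (fun i j => T₃ j i)
    (fun i j => T₂ j i) fun i j => T₄ j i) : Solvable T₁ T₂ T₃ T₄ := by
  obtain ⟨b, b', r, r', h1, h2, h3, h4⟩ := h
  exact ⟨r, r', b, b', h1.transpose, h3.transpose, h2.transpose, h4.transpose⟩

theorem IsGridLabelling.terminals_add (h : IsGridLabelling T₁ T₂ T₃ T₄) :
    terminals T₁ + terminals T₂ + terminals T₃ + terminals T₄ = 8 := by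
  have := h.5 1 (by simp)
  have := h.5 2 (by simp)
  have := h.5 3 (by simp)
  have := h.5 4 (by simp)
  simp only [terminals, List.map_cons, List.map_nil, List.sum_cons, List.sum_nil]
  omega

/-- A label occurs once in one half exactly if it does in the other, so both face the same list of
patterns. The two thresholds exceed its length in sum, and a pattern is shared. -/
theorem IsGridLabelling.solvable_of_half (h : IsGridLabelling T₁ T₂ T₃ T₄)
    (h3 : 3 ≤ terminals T₁ + terminals T₂) (h5 : terminals T₁ + terminals T₂ ≤ 5) :
    Solvable T₁ T₂ T₃ T₄ := by
  classical
  have h8 := h.terminals_add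
  have hl := le_countP (T₁ := T₁) (T₂ := T₂) ⟨h.1, h.2, fun l hl => by have := h.5 l hl; omega⟩ h3 h5
  have hr := le_countP (T₁ := T₃) (T₂ := T₄) ⟨h.3, h.4, fun l hl => by have := h.5 l hl; omega⟩
    (by omega) (by omega)
  have e : crossings T₃ T₄ = crossings T₁ T₂ := by
    unfold crossings
    refine List.filter_congr fun l hl => ?_
    have := h.5 l hl
    rw [decide_eq_decide]
    omega
  rw [e] at hr
  set l := patterns (crossings T₁ T₂) with hl_def
  have hex : ∃ k ∈ l, HalfRealizes T₁ T₂ k ∧ HalfRealizes T₃ T₄ k := by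
    by_contra hn
    have hsum : l.countP (HalfRealizes T₁ T₂) + l.countP (HalfRealizes T₃ T₄) ≤ l.length := by
      rw [List.length_eq_countP_add_countP (HalfRealizes T₁ T₂)]
      refine Nat.add_le_add_left (List.countP_mono_left fun k hk h4 => ?_) _
      simp only [decide_eq_true_eq] at h4 ⊢
      exact fun h' => hn ⟨k, hk, h', h4⟩
    have hthr : l.length < threshold (terminals T₁ + terminals T₂) l.length +
        threshold (terminals T₃ + terminals T₄) l.length := by
      generalize l.length = c
      have e3 : threshold 3 c = c := rfl
      have e4 : threshold 4 c = c / 2 + 1 := rfl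
      have e5 : threshold 5 c = 1 := rfl
      have : terminals T₁ + terminals T₂ = 3 ∨ terminals T₁ + terminals T₂ = 4 ∨
        terminals T₁ + terminals T₂ = 5 := by omega
      rcases this with h | h | h
      · rw [h, show terminals T₃ + terminals T₄ = 5 by omega, e3, e5]; omega
      · rw [h, show terminals T₃ + terminals T₄ = 4 by omega, e4]; omega
      · rw [h, show terminals T₃ + terminals T₄ = 3 by omega, e3, e5]; omega
    omega
  obtain ⟨k, -, ⟨b, h1, h2⟩, b', h3, h4⟩ := hex
  exact ⟨b, b', _, _, h1, h2, h3, h4⟩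

theorem testBit_exitsFold (C₂ C₃ C₄ n : ℕ) (l : List ℕ) (acc : ℕ)
    (h : (exitsFold C₂ C₃ C₄ l acc).testBit n = true) :
    acc.testBit n = true ∨ ∃ k k', Nat.land (slice C₃ k) (slice C₄ k') ≠ 0 ∧
      (transfer C₂ k' k).testBit n = true := by
  induction l generalizing acc with
  | nil => exact Or.inl h
  | cons k l ih =>
    have e : exitsFold C₂ C₃ C₄ (k :: l) acc =
        bif Nat.beq (Nat.land (slice C₃ (Nat.mod k 125)) (slice C₄ (Nat.div k 125))) 0 then
          exitsFold C₂ C₃ C₄ l acc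
        else force (Nat.lor acc (transfer C₂ (Nat.div k 125) (Nat.mod k 125)))
          (exitsFold C₂ C₃ C₄ l) := rfl
    rw [e] at h
    rcases hb : Nat.beq (Nat.land (slice C₃ (Nat.mod k 125)) (slice C₄ (Nat.div k 125))) 0
      with _ | _
    · rw [hb, cond_false, force_eq] at h
      rcases ih _ h with h | h
      · rw [testBit_lor'] at h
        refine h.imp_right fun h => ⟨_, _, fun h0 => ?_, h⟩
        rw [h0] at hb
        exact absurd hb (by decide)
      · exact Or.inr h
    · rw [hb, cond_true] at h
      exact ih _ h

theorem quarter_test_sound (h : IsGridLabelling T₁ T₂ T₃ T₄)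
    (hp : passes (run cells (flat T₁) 1) (quarterTest (rolesOf T₁ T₂ T₃ T₄)) = true) :
    Solvable T₁ T₂ T₃ T₄ := by
  rw [quarterTest, force_eq, force_eq, force_eq] at hp
  have h1 := Nat.le_of_ble_eq_true (show Nat.ble 1 (hits _ [_]) = true from hp)
  rw [hits_cons] at h1
  by_cases hz : Nat.land (run cells (flat T₁) 1) (exitsFold
      (core (labelsBy (rolesOf T₁ T₂ T₃ T₄) fun r => r.2.1))
      (core (labelsBy (rolesOf T₁ T₂ T₃ T₄) fun r => r.2.2.1))
      (core (labelsBy (rolesOf T₁ T₂ T₃ T₄) fun r => r.2.2.2))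
      (candidates (rolesOf T₁ T₂ T₃ T₄)) 0) = 0
  · rw [if_pos hz] at h1
    exact absurd h1 (by change ¬ 1 ≤ 0; omega)
  obtain ⟨n, hn1, hn2⟩ := exists_testBit_of_land_ne_zero hz
  rcases testBit_exitsFold _ _ _ _ _ _ hn2 with hn2 | ⟨k, k', hk, hn2⟩
  · rw [Nat.zero_testBit] at hn2
    exact absurd hn2 (by decide)
  obtain ⟨b, hb, rfl, hn3⟩ := testBit_transfer hn2
  obtain ⟨b', hb1, hb2⟩ := exists_testBit_of_land_ne_zero hk
  obtain ⟨hb', hb1⟩ := testBit_slice hb1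
  obtain ⟨-, hb2⟩ := testBit_slice hb2
  exact ⟨digit b, digit b', digit k, digit k', realizes_of_testBit h.1 hb hn1,
    realizes_of_testBit_core h.2 (flat_filter_perm h.2) hb hn3,
    realizes_of_testBit_core h.3 (flat_filter_perm h.3) hb' hb1,
    realizes_of_testBit_core h.4 (flat_filter_perm h.4) hb' hb2⟩

theorem mem_quarterRoles {a b c d e : ℕ} (h : b = a) (h2 : b + c + d + e = 2) :
    (b, c, d, e) ∈ quarterRoles a := by
  subst h
  have h1 : b ≤ 2 := by omega
  have : c ≤ 2 := by omega
  have : d ≤ 2 := by omega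
  obtain rfl : e = 2 - b - c - d := by omega
  interval_cases b <;> interval_cases c <;> interval_cases d <;> first | omega | decide

theorem IsGridLabelling.map {σ : Equiv.Perm ℕ} (hσ : IsRelabelling σ)
    (h : IsGridLabelling T₁ T₂ T₃ T₄) :
    IsGridLabelling (fun i j => σ (T₁ i j)) (fun i j => σ (T₂ i j)) (fun i j => σ (T₃ i j))
      fun i j => σ (T₄ i j) :=
  ⟨hσ.map h.1, hσ.map h.2, hσ.map h.3, hσ.map h.4, fun l hl => by
    simp only [cnt_map']
    exact h.5 _ (hσ.symm.mem hl)⟩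

theorem Solvable.unmap {σ : Equiv.Perm ℕ} (h0 : σ 0 = 0)
    (h : Solvable (fun i j => σ (T₁ i j)) (fun i j => σ (T₂ i j)) (fun i j => σ (T₃ i j))
      fun i j => σ (T₄ i j)) : Solvable T₁ T₂ T₃ T₄ := by
  have h0' : σ.symm 0 = 0 := by rw [Equiv.symm_apply_eq, h0]
  obtain ⟨b, b', r, r', h1, h2, h3, h4⟩ := h
  have key : ∀ {T : ℕ → ℕ → ℕ} {r b : ℕ → ℕ}, Realizes (fun i j => σ (T i j)) r b →
      Realizes T (fun i => σ.symm (r i)) fun j => σ.symm (b j) := fun h => by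
    have := h.map σ.symm.injective h0'
    simpa only [Equiv.symm_apply_apply] using this
  exact ⟨_, _, _, _, key h1, key h2, key h3, key h4⟩

/-- The southern and the eastern half have at most two terminals each, and the first quadrant at
least four; only the latter needs to be enumerated. -/
theorem IsGridLabelling.solvable_of_quarter (h : IsGridLabelling T₁ T₂ T₃ T₄)
    (h23 : terminals T₂ ≤ terminals T₃) (h12 : 6 ≤ terminals T₁ + terminals T₂)
    (h13 : 6 ≤ terminals T₁ + terminals T₃) : Solvable T₁ T₂ T₃ T₄ := by
  have h8 := h.terminals_add
  obtain ⟨σ, m, a, hσ, hcol, hp⟩ := exists_relabelling h.1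
    (fun l hl => by have := h.5 l hl; omega) (by omega)
  have h' := h.map hσ
  refine Solvable.unmap hσ.zero ?_
  have hn : ∀ T, terminals (fun i j => σ (T i j)) = terminals T := fun T => terminals_map hσ T
  rw [← hn T₁, ← hn T₂] at h12
  rw [← hn T₁, ← hn T₃] at h13
  rw [← hn T₂, ← hn T₃] at h23
  generalize (fun i j => σ (T₁ i j)) = U₁ at *
  generalize (fun i j => σ (T₂ i j)) = U₂ at *
  generalize (fun i j => σ (T₃ i j)) = U₃ at *
  generalize (fun i j => σ (T₄ i j)) = U₄ at *
  have hmem : rolesOf U₁ U₂ U₃ U₄ ∈ product quarterRoles (columns m a) :=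
    mem_product (g := roleOf U₁ U₂ U₃ U₄) fun l hl => mem_quarterRoles (hcol l hl) (h'.5 l hl)
  have ht : ∀ T : ℕ → ℕ → ℕ, terminals T = cnt T 1 + (cnt T 2 + (cnt T 3 + cnt T 4)) := fun T => by
    simp [terminals]
  have e₁ : (total (rolesOf U₁ U₂ U₃ U₄) fun r => r.1) = terminals U₁ := by rw [ht]; rfl
  have e₂ : (total (rolesOf U₁ U₂ U₃ U₄) fun r => r.2.1) = terminals U₂ := by rw [ht]; rfl
  have e₃ : (total (rolesOf U₁ U₂ U₃ U₄) fun r => r.2.2.1) = terminals U₃ := by rw [ht]; rfl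
  have hq : isQuarter (rolesOf U₁ U₂ U₃ U₄) = true := by
    simp only [isQuarter, e₁, e₂, e₃, Bool.and_eq_true, Nat.ble_eq, Nat.add_eq]
    exact ⟨h23, h12, h13⟩
  exact quarter_test_sound h' (passes_of_passesAll hp
    (List.mem_append_right _ (List.mem_map_of_mem (List.mem_filter.2 ⟨hmem, hq⟩))))

/-- If no half has three to five terminals, one half of each splitting has at least six. These two
halves meet in a quadrant, which reflections carry to the north-west. -/
theorem IsGridLabelling.solvable (h : IsGridLabelling T₁ T₂ T₃ T₄) : Solvable T₁ T₂ T₃ T₄ := by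
  have quarter : ∀ {T₁ T₂ T₃ T₄ : ℕ → ℕ → ℕ}, IsGridLabelling T₁ T₂ T₃ T₄ →
      6 ≤ terminals T₁ + terminals T₂ → 6 ≤ terminals T₁ + terminals T₃ →
      Solvable T₁ T₂ T₃ T₄ := by
    intro T₁ T₂ T₃ T₄ h h12 h13
    rcases le_total (terminals T₂) (terminals T₃) with h23 | h23
    · exact h.solvable_of_quarter h23 h12 h13
    · refine Solvable.transpose (h.transpose.solvable_of_quarter ?_ ?_ ?_) <;>
        simpa only [terminals_transpose]
  have h8 := h.terminals_add
  by_cases h12 : 3 ≤ terminals T₁ + terminals T₂ ∧ terminals T₁ + terminals T₂ ≤ 5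
  · exact h.solvable_of_half h12.1 h12.2
  by_cases h13 : 3 ≤ terminals T₁ + terminals T₃ ∧ terminals T₁ + terminals T₃ ≤ 5
  · refine Solvable.transpose (h.transpose.solvable_of_half ?_ ?_) <;>
      simp only [terminals_transpose] <;> omega
  by_cases h1 : 6 ≤ terminals T₁ + terminals T₂ <;> by_cases h2 : 6 ≤ terminals T₁ + terminals T₃
  · exact quarter h h1 h2
  · exact (quarter h.flip (by omega) (by omega)).flip
  · exact (quarter h.mirror (by omega) (by omega)).mirror
  · exact (quarter h.mirror.flip (by omega) (by omega)).flip.mirror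

theorem Balanced.flip {t u l d r : ℕ} (h : Balanced t u l d r) : Balanced t d l u r := by
  intro k hk
  have := h k hk
  rw [Nat.even_iff] at *
  omega

theorem Balanced.mirror {t u l d r : ℕ} (h : Balanced t u l d r) : Balanced t u r d l := by
  intro k hk
  have := h k hk
  rw [Nat.even_iff] at *
  omega

/-- Compatible completions of the four quadrants give a labelling of the edges of the grid: `h i j`
and `v i j` are the labels of the edges to the left of and above the vertex `(i, j)`. -/
theorem Solvable.exists_labelling {F : ℕ → ℕ → ℕ}
    (h : Solvable F (fun i j => F (5 - i) j) (fun i j => F i (5 - j))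
      fun i j => F (5 - i) (5 - j)) :
    ∃ h v : ℕ → ℕ → ℕ, (∀ i < 6, h i 0 = 0 ∧ h i 6 = 0) ∧ (∀ j < 6, v 0 j = 0 ∧ v 6 j = 0) ∧
      ∀ i < 6, ∀ j < 6, Balanced (F i j) (v i j) (h i j) (v (i + 1) j) (h i (j + 1)) := by
  obtain ⟨b, b', r, r', ⟨h1, v1, hh1, hv1, hc1⟩, ⟨h2, v2, hh2, hv2, hc2⟩,
    ⟨h3, v3, hh3, hv3, hc3⟩, h4, v4, hh4, hv4, hc4⟩ := h
  have gh13 : ∀ i < 3, h1 i 3 = h3 i 3 := fun i hi => (hh1 i hi).2.trans (hh3 i hi).2.symm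
  have gh24 : ∀ i < 3, h2 i 3 = h4 i 3 := fun i hi => (hh2 i hi).2.trans (hh4 i hi).2.symm
  have gv12 : ∀ i < 3, v1 3 i = v2 3 i := fun i hi => (hv1 i hi).2.trans (hv2 i hi).2.symm
  have gv34 : ∀ i < 3, v3 3 i = v4 3 i := fun i hi => (hv3 i hi).2.trans (hv4 i hi).2.symm
  -- Reflection takes vertex index i to 5 - i but edge index j to 6 - j. Index 3 is thus the edge
  -- across the middle, shared by two quadrants whose labels agree there.
  let H : ℕ → ℕ → ℕ := fun i j =>
    if i < 3 then if j ≤ 3 then h1 i j else h3 i (6 - j)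
    else if j ≤ 3 then h2 (5 - i) j else h4 (5 - i) (6 - j)
  let W : ℕ → ℕ → ℕ := fun i j =>
    if j < 3 then if i ≤ 3 then v1 i j else v2 (6 - i) j
    else if i ≤ 3 then v3 i (5 - j) else v4 (6 - i) (5 - j)
  have H1 : ∀ i < 3, ∀ j ≤ 3, H i j = h1 i j := fun i hi j hj => by
    simp only [H, if_pos hi, if_pos hj]
  have H2 : ∀ i < 3, ∀ j ≤ 3, H (5 - i) j = h2 i j := fun i hi j hj => by
    simp only [H, if_neg (show ¬ 5 - i < 3 by omega), if_pos hj, show 5 - (5 - i) = i by omega]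
  have H3 : ∀ i < 3, ∀ j ≤ 3, H i (6 - j) = h3 i j := fun i hi j hj => by
    rcases hj.eq_or_lt with rfl | hj
    · exact (H1 i hi 3 le_rfl).trans (gh13 i hi)
    · simp only [H, if_pos hi, if_neg (show ¬ 6 - j ≤ 3 by omega), show 6 - (6 - j) = j by omega]
  have H4 : ∀ i < 3, ∀ j ≤ 3, H (5 - i) (6 - j) = h4 i j := fun i hi j hj => by
    rcases hj.eq_or_lt with rfl | hj
    · exact (H2 i hi 3 le_rfl).trans (gh24 i hi)
    · simp only [H, if_neg (show ¬ 5 - i < 3 by omega), if_neg (show ¬ 6 - j ≤ 3 by omega),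
        show 6 - (6 - j) = j by omega, show 5 - (5 - i) = i by omega]
  have W1 : ∀ i < 3, ∀ j ≤ 3, W j i = v1 j i := fun i hi j hj => by
    simp only [W, if_pos hi, if_pos hj]
  have W3 : ∀ i < 3, ∀ j ≤ 3, W j (5 - i) = v3 j i := fun i hi j hj => by
    simp only [W, if_neg (show ¬ 5 - i < 3 by omega), if_pos hj, show 5 - (5 - i) = i by omega]
  have W2 : ∀ i < 3, ∀ j ≤ 3, W (6 - j) i = v2 j i := fun i hi j hj => by
    rcases hj.eq_or_lt with rfl | hj
    · exact (W1 i hi 3 le_rfl).trans (gv12 i hi)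
    · simp only [W, if_pos hi, if_neg (show ¬ 6 - j ≤ 3 by omega), show 6 - (6 - j) = j by omega]
  have W4 : ∀ i < 3, ∀ j ≤ 3, W (6 - j) (5 - i) = v4 j i := fun i hi j hj => by
    rcases hj.eq_or_lt with rfl | hj
    · exact (W3 i hi 3 le_rfl).trans (gv34 i hi)
    · simp only [W, if_neg (show ¬ 5 - i < 3 by omega), if_neg (show ¬ 6 - j ≤ 3 by omega),
        show 6 - (6 - j) = j by omega, show 5 - (5 - i) = i by omega]
  have split : ∀ i < 6, i < 3 ∨ ∃ i' < 3, i = 5 - i' := fun i hi => by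
    by_cases h : i < 3
    · exact Or.inl h
    · exact Or.inr ⟨5 - i, by omega, by omega⟩
  have e0 : ∀ i, 6 - (i + 1) = 5 - i := fun i => by omega
  have e1 : ∀ i < 3, 5 - i + 1 = 6 - i := fun i hi => by omega
  refine ⟨H, W, fun i hi6 => ?_, fun j hj6 => ?_, fun i hi6 j hj6 => ?_⟩
  · rcases split i hi6 with hi | ⟨i, hi, rfl⟩
    · exact ⟨(H1 i hi 0 (by omega)).trans (hh1 i hi).1, (H3 i hi 0 (by omega)).trans (hh3 i hi).1⟩
    · exact ⟨(H2 i hi 0 (by omega)).trans (hh2 i hi).1, (H4 i hi 0 (by omega)).trans (hh4 i hi).1⟩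
  · rcases split j hj6 with hj | ⟨j, hj, rfl⟩
    · exact ⟨(W1 j hj 0 (by omega)).trans (hv1 j hj).1, (W2 j hj 0 (by omega)).trans (hv2 j hj).1⟩
    · exact ⟨(W3 j hj 0 (by omega)).trans (hv3 j hj).1, (W4 j hj 0 (by omega)).trans (hv4 j hj).1⟩
  · rcases split i hi6 with hi | ⟨i, hi, rfl⟩ <;> rcases split j hj6 with hj | ⟨j, hj, rfl⟩
    · rw [H1 i hi j (by omega), H1 i hi (j + 1) (by omega), W1 j hj i (by omega),
        W1 j hj (i + 1) (by omega)]
      exact hc1 i hi j hj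
    · rw [e1 j hj, H3 i hi j (by omega), ← e0, H3 i hi (j + 1) (by omega), e0,
        W3 j hj i (by omega), W3 j hj (i + 1) (by omega)]
      exact (hc3 i hi j hj).mirror
    · rw [e1 i hi, H2 i hi j (by omega), H2 i hi (j + 1) (by omega), W2 j hj i (by omega),
        ← e0, W2 j hj (i + 1) (by omega), e0]
      exact (hc2 i hi j hj).flip
    · rw [e1 i hi, e1 j hj, H4 i hi j (by omega), W4 j hj i (by omega), ← e0 j,
        H4 i hi (j + 1) (by omega), e0 j, ← e0 i, W4 j hj (i + 1) (by omega), e0 i]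
      exact (hc4 i hi j hj).flip.mirror

end GridRouting

/-! ### From edge labels to edge-disjoint paths -/

namespace SimpleGraph

variable {V : Type*}

/-- If exactly two vertices have odd degree, they are connected. -/
theorem reachable_of_odd_degree [Fintype V] (G : SimpleGraph V) [DecidableRel G.Adj] {s t : V}
    (hs : Odd (G.degree s)) (h : ∀ x, Odd (G.degree x) → x = s ∨ x = t) : G.Reachable s t := by
  classical
  -- Keeping only the component of s preserves the degrees inside it and makes all others 0, so the
  -- second odd vertex from the handshake lemma is reachable.
  let H : SimpleGraph V :=
    { Adj := fun x y => G.Adj x y ∧ G.Reachable s x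
      symm := ⟨fun x y h => ⟨h.1.symm, h.2.trans h.1.reachable⟩⟩
      loopless := ⟨fun x h => G.loopless.irrefl x h.1⟩ }
  have hdeg : ∀ x, G.Reachable s x → H.degree x = G.degree x := fun x hx => by
    rw [← card_neighborFinset_eq_degree, ← card_neighborFinset_eq_degree]
    congr 1
    ext y
    simp [H, hx]
  obtain ⟨w, hw, hodd⟩ := H.exists_ne_odd_degree_of_exists_odd_degree s
    (by rwa [hdeg s (Reachable.refl s)])
  have hsw : G.Reachable s w := by
    by_contra hn
    have : H.degree w = 0 := by
      rw [← card_neighborFinset_eq_degree, Finset.card_eq_zero]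
      ext y
      simp [H, hn]
    rw [this] at hodd
    exact absurd hodd (by decide)
  rw [hdeg w hsw] at hodd
  rcases h w hodd with rfl | rfl
  · exact absurd rfl hw
  · exact hsw

/-- Subgraphs with disjoint edge sets, in each of which exactly one pair of terminals has odd
degree, give a linkage. -/
theorem hasEdgeDisjointLinkage_of_odd_degree [Fintype V] {G : SimpleGraph V} {k : ℕ}
    {s t : Fin k → V} (H : Fin k → SimpleGraph V) [∀ i, DecidableRel (H i).Adj]
    (hle : ∀ i, H i ≤ G) (hdisj : ∀ i j, i ≠ j → ∀ x y, (H i).Adj x y → ¬ (H j).Adj x y)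
    (hodd : ∀ i x, Odd ((H i).degree x) ↔ x = s i ∨ x = t i) : G.HasEdgeDisjointLinkage s t := by
  classical
  have hr : ∀ i, (H i).Reachable (s i) (t i) := fun i =>
    (H i).reachable_of_odd_degree ((hodd i _).2 (Or.inl rfl)) fun x hx => (hodd i x).1 hx
  let p := fun i => (hr i).some
  have hq : ∀ i e, e ∈ (((p i).toPath : (H i).Walk (s i) (t i)).mapLe (hle i)).edges →
      e ∈ (H i).edgeSet := fun i e he => by
    rw [Walk.edges_mapLe_eq_edges] at he
    exact Walk.edges_subset_edgeSet _ he
  refine ⟨fun i => ⟨((p i).toPath : (H i).Walk (s i) (t i)).mapLe (hle i),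
    (Walk.isPath_mapLe (hle i)).2 (p i).toPath.2⟩, fun i j hij e hi hj => ?_⟩
  have h1 := hq i e hi
  have h2 := hq j e hj
  induction e using Sym2.ind with
  | _ x y => exact hdisj i j hij x y h1 h2

theorem grid_adj {a b : ℕ} (x y : Fin a × Fin b) : (grid a b).Adj x y ↔
    (x.1 : ℕ) = y.1 ∧ ((x.2 : ℕ) + 1 = y.2 ∨ (y.2 : ℕ) + 1 = x.2) ∨
    (x.2 : ℕ) = y.2 ∧ ((x.1 : ℕ) + 1 = y.1 ∨ (y.1 : ℕ) + 1 = x.1) := by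
  rw [grid, boxProd_adj, pathGraph_adj, pathGraph_adj, Fin.ext_iff, Fin.ext_iff]
  tauto

end SimpleGraph

namespace GridRouting

open SimpleGraph

/-- The spanning subgraph of the grid formed by the edges with label `k`. -/
def layer (h v : ℕ → ℕ → ℕ) (k : ℕ) : SimpleGraph (Fin 6 × Fin 6) where
  Adj x y :=
    (x.1 = y.1 ∧ ((y.2 : ℕ) + 1 = x.2 ∧ h x.1 x.2 = k ∨ (x.2 : ℕ) + 1 = y.2 ∧ h y.1 y.2 = k)) ∨
    (x.2 = y.2 ∧ ((y.1 : ℕ) + 1 = x.1 ∧ v x.1 x.2 = k ∨ (x.1 : ℕ) + 1 = y.1 ∧ v y.1 y.2 = k))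
  symm := ⟨fun x y hxy => hxy.imp (fun h => ⟨h.1.symm, h.2.symm⟩) fun h => ⟨h.1.symm, h.2.symm⟩⟩
  loopless := ⟨fun x hx => by omega⟩

theorem layer_le (h v : ℕ → ℕ → ℕ) (k : ℕ) : layer h v k ≤ grid 6 6 := by
  intro x y hxy
  rw [grid_adj]
  simp only [layer, Fin.ext_iff] at hxy
  tauto

theorem layer_disjoint (h v : ℕ → ℕ → ℕ) {k k' : ℕ} (hk : k ≠ k') (x y : Fin 6 × Fin 6)
    (hxy : (layer h v k).Adj x y) : ¬ (layer h v k').Adj x y := by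
  intro hxy'
  simp only [layer, Fin.ext_iff] at hxy hxy'
  omega

theorem card_filter_eq_hit {α : Type} [Fintype α] (p : α → Prop) [DecidablePred p] {k l : ℕ}
    (h1 : l = k → ∃ x, ∀ y, p y ↔ y = x) (h2 : l ≠ k → ∀ y, ¬ p y) :
    (Finset.univ.filter p).card = hit k l := by
  by_cases h : l = k
  · obtain ⟨x, hx⟩ := h1 h
    rw [hit, if_pos h, Finset.card_eq_one]
    exact ⟨x, by ext y; simp [hx]⟩
  · rw [hit, if_neg h, Finset.card_eq_zero, Finset.filter_eq_empty_iff]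
    exact fun y _ => h2 h y

/-- Directions leading out of the grid carry label 0 and contribute nothing when k ≠ 0. -/
theorem degree_layer {h v : ℕ → ℕ → ℕ} {k : ℕ} (hk : k ≠ 0)
    (hh : ∀ i < 6, h i 0 = 0 ∧ h i 6 = 0) (hv : ∀ j < 6, v 0 j = 0 ∧ v 6 j = 0)
    [DecidableRel (layer h v k).Adj] (x : Fin 6 × Fin 6) :
    (layer h v k).degree x =
      hit k (v x.1 x.2) + hit k (h x.1 x.2) + hit k (v (x.1 + 1) x.2) + hit k (h x.1 (x.2 + 1)) := by
  classical
  obtain ⟨⟨i, hi⟩, ⟨j, hj⟩⟩ := x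
  simp only
  have hU : (Finset.univ.filter fun y : Fin 6 × Fin 6 =>
      (y.2 : ℕ) = j ∧ (y.1 : ℕ) + 1 = i ∧ v i j = k).card = hit k (v i j) := by
    refine card_filter_eq_hit _ (fun h => ?_) fun h y hy => h hy.2.2
    have : i ≠ 0 := by rintro rfl; exact hk (h.symm.trans (hv j hj).1)
    refine ⟨(⟨i - 1, by omega⟩, ⟨j, hj⟩), fun y => ?_⟩
    rw [Prod.ext_iff, Fin.ext_iff, Fin.ext_iff]
    simp only
    omega
  have hL : (Finset.univ.filter fun y : Fin 6 × Fin 6 =>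
      (y.1 : ℕ) = i ∧ (y.2 : ℕ) + 1 = j ∧ h i j = k).card = hit k (h i j) := by
    refine card_filter_eq_hit _ (fun h => ?_) fun h y hy => h hy.2.2
    have : j ≠ 0 := by rintro rfl; exact hk (h.symm.trans (hh i hi).1)
    refine ⟨(⟨i, hi⟩, ⟨j - 1, by omega⟩), fun y => ?_⟩
    rw [Prod.ext_iff, Fin.ext_iff, Fin.ext_iff]
    simp only
    omega
  have hD : (Finset.univ.filter fun y : Fin 6 × Fin 6 =>
      (y.2 : ℕ) = j ∧ i + 1 = (y.1 : ℕ) ∧ v (i + 1) j = k).card = hit k (v (i + 1) j) := by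
    refine card_filter_eq_hit _ (fun h => ?_) fun h y hy => h hy.2.2
    have : i ≠ 5 := by rintro rfl; exact hk (h.symm.trans (hv j hj).2)
    refine ⟨(⟨i + 1, by omega⟩, ⟨j, hj⟩), fun y => ?_⟩
    rw [Prod.ext_iff, Fin.ext_iff, Fin.ext_iff]
    simp only
    omega
  have hR : (Finset.univ.filter fun y : Fin 6 × Fin 6 =>
      (y.1 : ℕ) = i ∧ j + 1 = (y.2 : ℕ) ∧ h i (j + 1) = k).card = hit k (h i (j + 1)) := by
    refine card_filter_eq_hit _ (fun h => ?_) fun h y hy => h hy.2.2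
    have : j ≠ 5 := by rintro rfl; exact hk (h.symm.trans (hh i hi).2)
    refine ⟨(⟨i, hi⟩, ⟨j + 1, by omega⟩), fun y => ?_⟩
    rw [Prod.ext_iff, Fin.ext_iff, Fin.ext_iff]
    simp only
    omega
  rw [← hU, ← hL, ← hD, ← hR, ← Finset.card_union_of_disjoint, ← Finset.card_union_of_disjoint,
    ← Finset.card_union_of_disjoint, ← card_neighborFinset_eq_degree]
  · congr 1
    ext y
    simp only [mem_neighborFinset, Finset.mem_union, Finset.mem_filter, Finset.mem_univ, true_and]
    simp only [layer, Fin.ext_iff]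
    constructor
    · rintro (⟨h1, ⟨h2, h3⟩ | ⟨h2, h3⟩⟩ | ⟨h1, ⟨h2, h3⟩ | ⟨h2, h3⟩⟩)
      · exact Or.inl (Or.inl (Or.inr ⟨h1.symm, h2, h3⟩))
      · exact Or.inr ⟨h1.symm, h2, by rw [h1, h2]; exact h3⟩
      · exact Or.inl (Or.inl (Or.inl ⟨h1.symm, h2, h3⟩))
      · exact Or.inl (Or.inr ⟨h1.symm, h2, by rw [h1, h2]; exact h3⟩)
    · rintro (((⟨h1, h2, h3⟩ | ⟨h1, h2, h3⟩) | ⟨h1, h2, h3⟩) | ⟨h1, h2, h3⟩)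
      · exact Or.inr ⟨h1.symm, Or.inl ⟨h2, h3⟩⟩
      · exact Or.inl ⟨h1.symm, Or.inl ⟨h2, h3⟩⟩
      · exact Or.inr ⟨h1.symm, Or.inr ⟨h2, by rw [h1, ← h2]; exact h3⟩⟩
      · exact Or.inl ⟨h1.symm, Or.inr ⟨h2, by rw [h1, ← h2]; exact h3⟩⟩
  all_goals
    rw [Finset.disjoint_left]
    intro y
    simp only [Finset.mem_union, Finset.mem_filter, Finset.mem_univ, true_and]
    omega

theorem exists_vertex_labels {V : Type*} {k : ℕ} {s t : Fin k → V} (h : IsTerminalPairing s t) :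
    ∃ T : V → ℕ, (∀ x, T x ≤ k) ∧ ∀ (i : Fin k) x, T x = i + 1 ↔ x = s i ∨ x = t i := by
  classical
  refine ⟨fun x => if h : ∃ i, x = s i ∨ x = t i then h.choose + 1 else 0, fun x => ?_,
    fun i x => ?_⟩
  · dsimp only
    split_ifs with hx
    · exact hx.choose.2
    · exact Nat.zero_le _
  · have uniq : ∀ i j, (x = s i ∨ x = t i) → (x = s j ∨ x = t j) → i = j := by
      rintro i j (rfl | rfl) (h' | h')
      · exact Sum.inl.inj (h (a₁ := Sum.inl i) (a₂ := Sum.inl j) h')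
      · exact absurd (h (a₁ := Sum.inl i) (a₂ := Sum.inr j) h') (by simp)
      · exact absurd (h (a₁ := Sum.inr i) (a₂ := Sum.inl j) h') (by simp)
      · exact Sum.inr.inj (h (a₁ := Sum.inr i) (a₂ := Sum.inr j) h')
    dsimp only
    split_ifs with hx
    · constructor
      · intro e
        have : hx.choose = i := Fin.ext (by omega)
        exact this ▸ hx.choose_spec
      · intro e
        rw [uniq _ _ hx.choose_spec e]
    · exact ⟨fun e => e.elim, fun e => absurd ⟨i, e⟩ hx⟩

theorem card_label_eq_two {V : Type*} [Fintype V] {k : ℕ} {s t : Fin k → V}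
    (h : IsTerminalPairing s t) {T : V → ℕ}
    (hT : ∀ (i : Fin k) x, T x = i + 1 ↔ x = s i ∨ x = t i) (i : Fin k) :
    ∑ x, (if T x = i + 1 then 1 else 0) = 2 := by
  classical
  rw [← Finset.card_filter]
  have hne : s i ≠ t i := fun e =>
    absurd (h (a₁ := Sum.inl i) (a₂ := Sum.inr i) e) (by simp)
  rw [← Finset.card_pair hne]
  congr 1
  ext x
  simp [hT]

theorem isGridLabelling_of_sum {F : ℕ → ℕ → ℕ} (hlt : ∀ i j, F i j < 5)
    (hsum : ∀ l ∈ [1, 2, 3, 4],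
      ∑ i ∈ Finset.range 6, ∑ j ∈ Finset.range 6, (if F i j = l then 1 else 0) = 2) :
    IsGridLabelling F (fun i j => F (5 - i) j) (fun i j => F i (5 - j))
      fun i j => F (5 - i) (5 - j) := by
  have hl : ∀ f : ℕ → ℕ → ℕ, (∀ i j, f i j < 5) → IsLabelling f := fun f hf t ht => by
    simp only [flat, List.mem_cons, List.not_mem_nil, or_false] at ht
    rcases ht with rfl | rfl | rfl | rfl | rfl | rfl | rfl | rfl | rfl <;> exact hf _ _
  refine ⟨hl _ hlt, hl _ fun _ _ => hlt _ _, hl _ fun _ _ => hlt _ _, hl _ fun _ _ => hlt _ _,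
    fun l hl => ?_⟩
  have := hsum l hl
  simp only [Finset.sum_range_succ, Finset.sum_range_zero, zero_add] at this
  have e : ∀ (x : ℕ) (L : List ℕ), (x :: L).count l = L.count l + if x = l then 1 else 0 :=
    fun x L => by by_cases hx : x = l <;> simp [hx]
  simp only [cnt, flat, e, List.count_nil, Nat.reduceSub, Nat.sub_zero]
  refine Eq.trans ?_ this
  ring

theorem isPathPairable_four : (grid 6 6).IsPathPairable 4 := by
  classical
  intro s t hst
  obtain ⟨T, hT4, hT⟩ := exists_vertex_labels hst
  -- `Fin.ofNat` reduces modulo 6; only arguments below 6 matter.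
  let F : ℕ → ℕ → ℕ := fun i j => T (Fin.ofNat 6 i, Fin.ofNat 6 j)
  have hF : ∀ x : Fin 6 × Fin 6, F x.1 x.2 = T x := fun x => by
    simp only [F, Fin.ofNat_eq_cast, Fin.cast_val_eq_self]
  have hsum : ∀ l ∈ [1, 2, 3, 4],
      ∑ i ∈ Finset.range 6, ∑ j ∈ Finset.range 6, (if F i j = l then 1 else 0) = 2 := by
    intro l hl
    rw [mem_labels] at hl
    have := card_label_eq_two hst hT ⟨l - 1, by omega⟩
    rw [Fintype.sum_prod_type] at this
    simp only [Nat.sub_add_cancel (show 1 ≤ l by omega), ← hF] at this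
    rw [Finset.sum_range, ← this]
    refine Finset.sum_congr rfl fun i _ => ?_
    rw [Finset.sum_range]
  obtain ⟨h, v, hh, hv, hb⟩ :=
    (isGridLabelling_of_sum (F := F) (fun i j => Nat.lt_succ_of_le (hT4 _)) hsum).solvable.exists_labelling
  refine hasEdgeDisjointLinkage_of_odd_degree (fun i : Fin 4 => layer h v (i + 1))
    (fun i => layer_le _ _ _) (fun i j hij => layer_disjoint _ _ fun e => hij (Fin.ext (by omega)))
    fun i x => ?_
  have hi0 : (i : ℕ) + 1 ≠ 0 := by omega
  rw [← hT, degree_layer hi0 hh hv]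
  have := hb x.1 x.1.2 x.2 x.2.2 (i + 1) hi0
  rw [hF x] at this
  rw [Nat.odd_iff]
  rw [Nat.even_iff] at this
  by_cases hx : T x = i + 1
  · rw [hit, if_pos hx] at this
    simp only [hx, iff_true]
    omega
  · rw [hit, if_neg hx] at this
    simp only [hx, iff_false]
    omega

end GridRouting

/-! ### The corner obstruction to five pairs -/

namespace SimpleGraph

variable {V : Type*} {G : SimpleGraph V}

theorem Walk.IsTrail.countP_edges_eq [DecidableEq V] {u w : V} {p : G.Walk u w} (hp : p.IsTrail)
    (x : V) {l : List V} (hl : l.Nodup) (hx : ∀ y, G.Adj x y → y ∈ l) :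
    p.edges.countP (x ∈ ·) = l.countP (s(x, ·) ∈ p.edges) := by
  have hinj : Function.Injective fun y => s(x, y) := fun y z h => Sym2.congr_right.1 h
  have hperm : (p.edges.filter (x ∈ ·)).Perm
      ((l.filter (s(x, ·) ∈ p.edges)).map fun y => s(x, y)) := by
    rw [List.perm_ext_iff_of_nodup (hp.edges_nodup.filter _) ((hl.filter _).map hinj)]
    intro e
    simp only [List.mem_filter, List.mem_map, decide_eq_true_eq]
    constructor
    · rintro ⟨he, hxe⟩
      obtain ⟨y, rfl⟩ := hxe
      exact ⟨y, ⟨hx y (p.adj_of_mem_edges he), he⟩, rfl⟩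
    · rintro ⟨y, ⟨-, he⟩, rfl⟩
      exact ⟨he, Sym2.mem_mk_left x y⟩
  rw [List.countP_eq_length_filter, List.countP_eq_length_filter, hperm.length_eq, List.length_map]

end SimpleGraph

namespace GridRouting

open SimpleGraph

/-- Every nonzero number occurs an even number of times in the list. -/
def EvenCounts (l : List ℕ) : Prop := ∀ k ≠ 0, Even (l.count k)

/-- Converse of the passage from labels to paths: edges of the i-th path get label i + 1. A path has
an odd number of edges at a vertex exactly if the vertex is one of its two ends. -/
theorem exists_edge_labels {V : Type*} {G : SimpleGraph V} {n : ℕ} {s t : Fin n → V}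
    (hst : IsTerminalPairing s t) (h : G.HasEdgeDisjointLinkage s t) {T : V → ℕ}
    (hTn : ∀ x, T x ≤ n) (hT : ∀ (i : Fin n) x, T x = i + 1 ↔ x = s i ∨ x = t i) :
    ∃ c : V → V → ℕ, (∀ x y, c x y = c y x) ∧ ∀ (x : V) (l : List V), l.Nodup →
      (∀ y, G.Adj x y → y ∈ l) → EvenCounts (T x :: l.map (c x)) := by
  classical
  obtain ⟨P, hP⟩ := h
  have huniq : ∀ {e i j}, e ∈ (P i).1.edges → e ∈ (P j).1.edges → i = j := fun {e i j} hi hj => by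
    by_contra hij
    exact hP i j hij hi hj
  let L : Sym2 V → ℕ := fun e => if h : ∃ i, e ∈ (P i).1.edges then h.choose + 1 else 0
  have hL : ∀ e (i : Fin n), L e = i + 1 ↔ e ∈ (P i).1.edges := fun e i => by
    dsimp only [L]
    split_ifs with he
    · constructor
      · intro h
        have : he.choose = i := Fin.ext (by omega)
        exact this ▸ he.choose_spec
      · intro h
        rw [huniq he.choose_spec h]
    · exact ⟨fun h => h.elim, fun h => absurd ⟨i, h⟩ he⟩
  have hLn : ∀ e, L e ≤ n := fun e => by
    dsimp only [L]
    split_ifs with he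
    · exact he.choose.2
    · exact Nat.zero_le _
  refine ⟨fun x y => L s(x, y), fun x y => congrArg L Sym2.eq_swap, fun x l hl hx k hk => ?_⟩
  by_cases hkn : k ≤ n
  · obtain ⟨i, rfl⟩ : ∃ i : Fin n, k = i + 1 := ⟨⟨k - 1, by omega⟩, by simp only; omega⟩
    have hne : s i ≠ t i := fun e =>
      absurd (hst (a₁ := Sum.inl i) (a₂ := Sum.inr i) e) (by simp)
    have hcount : (l.map fun y => L s(x, y)).count ((i : ℕ) + 1) =
        (P i).1.edges.countP (x ∈ ·) := by
      rw [(P i).2.isTrail.countP_edges_eq x hl hx, List.count_eq_countP, List.countP_map]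
      refine List.countP_congr fun y _ => ?_
      simp [hL]
    have heven := (P i).2.isTrail.even_countP_edges_iff x
    rw [List.count_cons, hcount]
    by_cases hTx : T x = i + 1
    · have : ¬ Even ((P i).1.edges.countP (x ∈ ·)) := by
        rw [heven]
        rcases (hT i x).1 hTx with h | h <;> simp [h, hne, hne.symm]
      rw [hTx, if_pos (by simp)]
      exact (Nat.not_even_iff_odd.1 this).add_odd odd_one
    · have : Even ((P i).1.edges.countP (x ∈ ·)) := by
        rw [heven]
        intro _
        rw [hT] at hTx
        tauto
      rw [if_neg (by simpa using hTx)]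
      exact this
  · rw [List.count_eq_zero_of_not_mem]
    · exact ⟨0, rfl⟩
    · rw [List.mem_cons, List.mem_map, not_or]
      refine ⟨fun h => hkn (h ▸ hTn x), ?_⟩
      rintro ⟨y, -, h⟩
      exact hkn (h ▸ hLn _)

/-- The head needs a partner in the tail, and both can be cancelled. Repeating this yields the case
lists below. -/
theorem EvenCounts.exists_erase {t : ℕ} {l : List ℕ} (h : EvenCounts (t :: l)) (ht : t ≠ 0) :
    t ∈ l ∧ EvenCounts (l.erase t) := by
  have hmem : t ∈ l := by
    by_contra hn
    have := h t ht
    rw [List.count_cons_self, List.count_eq_zero_of_not_mem hn] at this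
    exact absurd this (by decide)
  refine ⟨hmem, fun k hk => ?_⟩
  have := h k hk
  rw [((List.perm_cons_erase hmem).cons t).count_eq, List.count_cons, List.count_cons] at this
  rw [Nat.even_iff] at *
  omega

theorem EvenCounts.two {x y : ℕ} (h : EvenCounts [x, y]) : x = y := by
  by_contra hxy
  by_cases hx : x = 0
  · have := h y (fun hy => hxy (hx.trans hy.symm))
    simp [hxy] at this
  · have := h x hx
    simp [Ne.symm hxy] at this

theorem EvenCounts.three {x y z : ℕ} (h : EvenCounts [x, y, z]) :
    x = 0 ∧ y = z ∨ y = 0 ∧ x = z ∨ z = 0 ∧ x = y := by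
  by_cases hx : x = 0
  · subst hx
    refine Or.inl ⟨rfl, EvenCounts.two fun k hk => ?_⟩
    have := h k hk
    rwa [List.count_cons, if_neg (by simpa using hk.symm)] at this
  · obtain ⟨h1, h2⟩ := h.exists_erase hx
    by_cases hxy : y = x
    · subst hxy
      rw [List.erase_cons_head] at h2
      by_contra hn
      have := h2 z (by tauto)
      simp at this
    · have hz : x = z := by simpa [Ne.symm hxy] using h1
      subst hz
      rw [List.erase_cons_tail (by simpa using hxy), List.erase_cons_head] at h2
      by_contra hn
      have := h2 y (by tauto)
      simp at this

theorem EvenCounts.four {t x y z : ℕ} (h : EvenCounts [t, x, y, z]) (ht : t ≠ 0) :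
    x = t ∧ y = z ∨ y = t ∧ x = z ∨ z = t ∧ x = y := by
  obtain ⟨h1, h2⟩ := h.exists_erase ht
  by_cases hx : x = t
  · subst hx
    rw [List.erase_cons_head] at h2
    exact Or.inl ⟨rfl, h2.two⟩
  rw [List.erase_cons_tail (by simpa using hx)] at h2
  by_cases hy : y = t
  · subst hy
    rw [List.erase_cons_head] at h2
    exact Or.inr (Or.inl ⟨rfl, h2.two⟩)
  rw [List.erase_cons_tail (by simpa using hy)] at h2
  have hz : t = z := by simpa [Ne.symm hx, Ne.symm hy] using h1
  subst hz
  rw [List.erase_cons_head] at h2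
  exact Or.inr (Or.inr ⟨rfl, h2.two⟩)

theorem EvenCounts.five {t x y z w : ℕ} (h : EvenCounts [t, x, y, z, w]) (ht : t ≠ 0) :
    (x = t ∧ (y = 0 ∧ z = w ∨ z = 0 ∧ y = w ∨ w = 0 ∧ y = z)) ∨
    (y = t ∧ (x = 0 ∧ z = w ∨ z = 0 ∧ x = w ∨ w = 0 ∧ x = z)) ∨
    (z = t ∧ (x = 0 ∧ y = w ∨ y = 0 ∧ x = w ∨ w = 0 ∧ x = y)) ∨
    (w = t ∧ (x = 0 ∧ y = z ∨ y = 0 ∧ x = z ∨ z = 0 ∧ x = y)) := by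
  obtain ⟨h1, h2⟩ := h.exists_erase ht
  by_cases hx : x = t
  · subst hx
    rw [List.erase_cons_head] at h2
    exact Or.inl ⟨rfl, h2.three⟩
  rw [List.erase_cons_tail (by simpa using hx)] at h2
  by_cases hy : y = t
  · subst hy
    rw [List.erase_cons_head] at h2
    exact Or.inr (Or.inl ⟨rfl, h2.three⟩)
  rw [List.erase_cons_tail (by simpa using hy)] at h2
  by_cases hz : z = t
  · subst hz
    rw [List.erase_cons_head] at h2
    exact Or.inr (Or.inr (Or.inl ⟨rfl, h2.three⟩))
  rw [List.erase_cons_tail (by simpa using hz)] at h2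
  have hw : t = w := by simpa [Ne.symm hx, Ne.symm hy, Ne.symm hz] using h1
  subst hw
  rw [List.erase_cons_head] at h2
  exact Or.inr (Or.inr (Or.inr ⟨rfl, h2.three⟩))

/-- One of p, q is 1 and the other 0. At (1, 1) neither m nor n is 5, and they are never equal, so
one of them is 0 while b or d is 5. This makes a and c nonzero, and e and h lie in {1, 2, 3}. The
edge labelled 5 ends at (1, 2) or (2, 1), a terminal of pair 4, where the distinct labels 4, 5 and e
(or h) would have to be matched on only two further edges. -/
theorem corner_labels_false {p q a b c d e h m n x₁ x₂ x₃ x₄ x₅ x₆ : ℕ}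
    (h00 : EvenCounts [1, p, q]) (h01 : EvenCounts [3, p, a, m]) (h10 : EvenCounts [2, q, n, c])
    (h11 : EvenCounts [5, m, n, b, d]) (h02 : EvenCounts [2, a, e, x₁])
    (h12 : EvenCounts [4, e, b, x₂, x₃]) (h20 : EvenCounts [3, c, h, x₄])
    (h21 : EvenCounts [4, d, h, x₅, x₆]) : False := by
  have h02 : a = 2 ∨ e = 2 ∨ a = e := by have := h02.four (by decide); omega
  have h20 : c = 3 ∨ h = 3 ∨ c = h := by have := h20.four (by decide); omega
  have h12 : e = 0 ∨ b = 0 ∨ e = 4 ∨ b = 4 ∨ e = b := by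
    rcases h12.five (by decide) with h' | h' | h' | h' <;> omega
  have h21 : d = 0 ∨ h = 0 ∨ d = 4 ∨ h = 4 ∨ d = h := by
    rcases h21.five (by decide) with h' | h' | h' | h' <;> omega
  have hab : p = 1 ∧ q = 0 ∨ p = 0 ∧ q = 1 := by have := h00.three; omega
  have ham : a = 3 ∧ m = p ∨ m = 3 ∧ a = p := by have := h01.four (by decide); omega
  have hcn : c = 2 ∧ n = q ∨ n = 2 ∧ c = q := by have := h10.four (by decide); omega
  have h11 := h11.five (by decide)
  rcases hab with ⟨rfl, rfl⟩ | ⟨rfl, rfl⟩ <;> rcases ham with ⟨rfl, rfl⟩ | ⟨rfl, rfl⟩ <;>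
    rcases hcn with ⟨rfl, rfl⟩ | ⟨rfl, rfl⟩ <;> simp at h11 <;>
    rcases h11 with ⟨rfl, rfl⟩ | ⟨rfl, rfl⟩ <;> omega

open SimpleGraph

def sources : Fin 5 → Fin 6 × Fin 6 := ![(0, 0), (1, 0), (2, 0), (2, 1), (1, 1)]

def targets (t₁ t₅ : Fin 6 × Fin 6) : Fin 5 → Fin 6 × Fin 6 := ![t₁, (0, 2), (0, 1), (1, 2), t₅]

theorem not_hasEdgeDisjointLinkage (t₁ t₅ : Fin 6 × Fin 6)
    (hst : IsTerminalPairing sources (targets t₁ t₅)) :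
    ¬ (grid 6 6).HasEdgeDisjointLinkage sources (targets t₁ t₅) := by
  intro hlink
  obtain ⟨T, hT5, hT⟩ := exists_vertex_labels hst
  obtain ⟨c, hc, hev⟩ := exists_edge_labels hst hlink hT5 hT
  have adj : ∀ (x : Fin 6 × Fin 6) (l : List (Fin 6 × Fin 6)),
      (∀ y : Fin 6 × Fin 6, (x.1 : ℕ) = y.1 ∧ ((x.2 : ℕ) + 1 = y.2 ∨ (y.2 : ℕ) + 1 = x.2) ∨
        (x.2 : ℕ) = y.2 ∧ ((x.1 : ℕ) + 1 = y.1 ∨ (y.1 : ℕ) + 1 = x.1) → y ∈ l) →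
      ∀ y, (grid 6 6).Adj x y → y ∈ l := fun x l h y hy => h y ((grid_adj x y).1 hy)
  have e00 := hev (0, 0) [(0, 1), (1, 0)] (by decide) (adj _ _ (by decide))
  have e01 := hev (0, 1) [(0, 0), (0, 2), (1, 1)] (by decide) (adj _ _ (by decide))
  have e10 := hev (1, 0) [(0, 0), (1, 1), (2, 0)] (by decide) (adj _ _ (by decide))
  have e11 := hev (1, 1) [(0, 1), (1, 0), (1, 2), (2, 1)] (by decide) (adj _ _ (by decide))
  have e02 := hev (0, 2) [(0, 1), (1, 2), (0, 3)] (by decide) (adj _ _ (by decide))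
  have e12 := hev (1, 2) [(0, 2), (1, 1), (1, 3), (2, 2)] (by decide) (adj _ _ (by decide))
  have e20 := hev (2, 0) [(1, 0), (2, 1), (3, 0)] (by decide) (adj _ _ (by decide))
  have e21 := hev (2, 1) [(1, 1), (2, 0), (2, 2), (3, 1)] (by decide) (adj _ _ (by decide))
  rw [(hT 0 (0, 0)).2 (Or.inl rfl)] at e00
  rw [(hT 2 (0, 1)).2 (Or.inr rfl)] at e01
  rw [(hT 1 (1, 0)).2 (Or.inl rfl)] at e10
  rw [(hT 4 (1, 1)).2 (Or.inl rfl)] at e11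
  rw [(hT 1 (0, 2)).2 (Or.inr rfl)] at e02
  rw [(hT 3 (1, 2)).2 (Or.inr rfl)] at e12
  rw [(hT 2 (2, 0)).2 (Or.inl rfl)] at e20
  rw [(hT 3 (2, 1)).2 (Or.inl rfl)] at e21
  simp only [List.map_cons, List.map_nil] at e00 e01 e10 e11 e02 e12 e20 e21
  rw [hc (0, 1) (0, 0)] at e01
  rw [hc (1, 0) (0, 0)] at e10
  rw [hc (1, 1) (0, 1), hc (1, 1) (1, 0)] at e11
  rw [hc (0, 2) (0, 1)] at e02
  rw [hc (1, 2) (0, 2), hc (1, 2) (1, 1)] at e12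
  rw [hc (2, 0) (1, 0)] at e20
  rw [hc (2, 1) (1, 1), hc (2, 1) (2, 0)] at e21
  exact corner_labels_false e00 e01 e10 e11 e02 e12 e20 e21

theorem isTerminalPairing_example : IsTerminalPairing sources (targets (5, 5) (5, 4)) := by
  unfold IsTerminalPairing
  decide

/-! ### The path-pairability number -/

/-- A pairing of `m` pairs extends to one of `k ≥ m` pairs if there is any pairing of `k` pairs. -/
theorem exists_pairing_extension {V : Type*} [Finite V] {m k : ℕ} (hmk : m ≤ k)
    {s t : Fin m → V} (hst : IsTerminalPairing s t) {s' t' : Fin k → V}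
    (hst' : IsTerminalPairing s' t') :
    ∃ s'' t'' : Fin k → V, IsTerminalPairing s'' t'' ∧ (∀ i, s'' (Fin.castLE hmk i) = s i) ∧
      ∀ i, t'' (Fin.castLE hmk i) = t i := by
  classical
  have hι : Function.Injective
      (Sum.elim (fun i => s' (Fin.castLE hmk i)) fun i => t' (Fin.castLE hmk i)) := by
    have e : (Sum.elim (fun i => s' (Fin.castLE hmk i)) fun i => t' (Fin.castLE hmk i)) =
        Sum.elim s' t' ∘ Sum.map (Fin.castLE hmk) (Fin.castLE hmk) := by
      ext (i | i) <;> rfl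
    rw [e]
    exact hst'.comp ((Fin.castLE_injective hmk).sumMap (Fin.castLE_injective hmk))
  -- Match the first m pairs of the larger pairing with the given ones, and extend this bijection to
  -- a permutation of all vertices.
  let e := (Equiv.ofInjective _ hι).symm.trans (Equiv.ofInjective _ hst)
  let σ : Equiv.Perm V := e.extendSubtype
  have hσ : ∀ x, σ (Sum.elim (fun i => s' (Fin.castLE hmk i)) (fun i => t' (Fin.castLE hmk i)) x) =
      Sum.elim s t x := fun x => by
    refine (e.extendSubtype_apply_of_mem _ ⟨x, rfl⟩).trans ?_
    simp only [e, Equiv.trans_apply]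
    rw [show (⟨_, ⟨x, rfl⟩⟩ : Set.range (Sum.elim (fun i => s' (Fin.castLE hmk i))
      fun i => t' (Fin.castLE hmk i))) = Equiv.ofInjective _ hι x from rfl, Equiv.symm_apply_apply]
    rfl
  refine ⟨σ ∘ s', σ ∘ t', ?_, fun i => hσ (Sum.inl i), fun i => hσ (Sum.inr i)⟩
  have : Sum.elim (σ ∘ s') (σ ∘ t') = σ ∘ Sum.elim s' t' := by
    ext (i | i) <;> rfl
  rw [IsTerminalPairing, this]
  exact σ.injective.comp hst'

theorem HasEdgeDisjointLinkage.restrict {V : Type*} {G : SimpleGraph V} {m k : ℕ} (hmk : m ≤ k)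
    {s t : Fin k → V} (h : G.HasEdgeDisjointLinkage s t) :
    G.HasEdgeDisjointLinkage (fun i => s (Fin.castLE hmk i)) fun i => t (Fin.castLE hmk i) := by
  obtain ⟨P, hP⟩ := h
  exact ⟨fun i => P (Fin.castLE hmk i), fun i j hij =>
    hP _ _ fun h => hij (Fin.castLE_injective hmk h)⟩

theorem not_isPathPairable {k : ℕ} (hk : 5 ≤ k) {s t : Fin k → Fin 6 × Fin 6}
    (hst : IsTerminalPairing s t) : ¬ (grid 6 6).IsPathPairable k := by
  intro h
  obtain ⟨s', t', hst', hs, ht⟩ := exists_pairing_extension hk isTerminalPairing_example hst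
  have := HasEdgeDisjointLinkage.restrict hk (h s' t' hst')
  simp only [hs, ht] at this
  exact not_hasEdgeDisjointLinkage _ _ isTerminalPairing_example this

theorem pathPairabilityNumber_grid : pathPairabilityNumber (grid 6 6) = 4 := by
  refine IsGreatest.csSup_eq ⟨⟨⟨![(0, 0), (0, 1), (0, 2), (0, 3)], ![(1, 0), (1, 1), (1, 2), (1, 3)],
    ?_⟩, isPathPairable_four⟩, ?_⟩
  · unfold IsTerminalPairing
    decide
  · rintro k ⟨⟨s, t, hst⟩, hk⟩
    by_contra hn
    exact not_isPathPairable (by omega) hst hk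

end GridRouting

theorem theorem2 :
    SimpleGraph.pathPairabilityNumber (SimpleGraph.grid 6 6) = 4 ∧
    (SimpleGraph.grid 6 6).IsPathPairable 4 ∧
    ¬ (SimpleGraph.grid 6 6).IsPathPairable 5 ∧
    (∀ t₁ t₅ : Fin 6 × Fin 6,
      SimpleGraph.IsTerminalPairing
          ![((0, 0) : Fin 6 × Fin 6), (1, 0), (2, 0), (2, 1), (1, 1)]
          ![t₁, (0, 2), (0, 1), (1, 2), t₅] →
        ¬ (SimpleGraph.grid 6 6).HasEdgeDisjointLinkage
          ![((0, 0) : Fin 6 × Fin 6), (1, 0), (2, 0), (2, 1), (1, 1)]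
          ![t₁, (0, 2), (0, 1), (1, 2), t₅]) :=
  ⟨GridRouting.pathPairabilityNumber_grid, GridRouting.isPathPairable_four,
    GridRouting.not_isPathPairable le_rfl GridRouting.isTerminalPairing_example,
    GridRouting.not_hasEdgeDisjointLinkage⟩
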